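/- Let $G$ be an elementary abelian $2$-group of rank $k\ge 2$, i.e. $G\cong (\mathbb Z/2)^k$. Then $$n_{\mathbb C}(G)=\frac12\Bigl(n(G)+\sum_{\chi\in \mathrm{Irr}_1(G)} m_{\mathbb Q}(\chi)\,\chi(1)\Bigr)=2^{k-1}+2^{k-2}(2^k-1).$$ Here, for a finite group $G$: * A $G$-lattice is a free abelian group of finite rank with a linear action of $G$. For a $G$-lattice $L$, a class $\alpha\in H^2(G,L)$ is *special* if its restriction to every nontrivial subgroup of $G$ is nonzero. The *Vasquez number* $n(G)$ is the smallest natural number $N$ such that every faithful $G$-lattice $L$ with a special element $\alpha\in H^2(G,L)$ has a $\mathbb Z$-pure $G$-submodule $W$ with $\operatorname{rk}_{\mathbb Z}(L/W)\le N$ for which the image of $\alpha$ in $H^2(G,L/W)$ is special. * An *aspherical Kähler group* of (complex) dimension $n$ is the fundamental group of a quotient of a compact complex $n$-torus by a free holomorphic action of a finite group. Such a group $\Gamma$ has a unique maximal abelian normal subgroup $L$, and $\Gamma/L$ is its holonomy group. The *complex Vasquez number* $n_{\mathbb C}(G)$ is the smallest natural number $N$ such that, for every aspherical Kähler group $\Gamma$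 (of any dimension) with holonomy group $G$ and maximal abelian normal subgroup $L$, there is a subgroup $M\subseteq L$, normal in $\Gamma$, such that $\Gamma/M$ is an aspherical Kähler group of dimension at most $N$. * $\mathrm{Irr}_1(G)$ is the set of complex irreducible characters $\chi$ of $G$ with Frobenius–Schur indicator $\nu_2(\chi)=\frac1{|G|}\sum_{g\in G}\chi(g^2)$ equal to $1$, and $m_{\mathbb Q}(\chi)$ is the Schur index of $\chi$ over $\mathbb Q$. -/

import Mathlib

noncomputable section

open CategoryTheory

/-! ### Lattices, special cohomology classes and the Vasquez number -/

/-- A class `α ∈ H²(G, L)` is *special* if its restriction to every nontrivial subgroup of `G`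
is nonzero. -/
def IsSpecial {G : Type} [Group G] (L : Rep ℤ G) (α : groupCohomology L 2) : Prop :=
  ∀ H : Subgroup G, H ≠ ⊥ →
    (groupCohomology.map H.subtype (𝟙 (Rep.res H.subtype L)) 2).hom α ≠ 0

/-- `N` is an admissible Vasquez bound for `G`: every faithful `G`-lattice `L`
(a free `ℤ`-module of finite rank with a faithful linear action of `G`) with a special
element `α` has a `ℤ`-pure `G`-submodule `W` such that `L / W` has rank at most `N` and the image
of `α` in `H²(G, L / W)` is special. -/
def IsVasquezBound (G : Type) [Group G] (N : ℕ) : Prop :=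
  ∀ (L : Type) [AddCommGroup L] [Module.Free ℤ L] [Module.Finite ℤ L]
    (ρ : Representation ℤ G L), Function.Injective ρ →
    ∀ α : groupCohomology (Rep.of ρ) 2, IsSpecial (Rep.of ρ) α →
      ∃ (W : Submodule ℤ L) (hW : ∀ g, W ≤ W.comap (ρ g)),
        (∀ (m : ℤ) (x : L), m ≠ 0 → m • x ∈ W → x ∈ W) ∧
        Module.finrank ℤ (L ⧸ W) ≤ N ∧
        IsSpecial ((Rep.of ρ).quotient W hW)
          ((groupCohomology.map (MonoidHom.id G) ((Rep.of ρ).mkQ W hW) 2).hom α)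

/-- The Vasquez number `n(G)`: the smallest admissible Vasquez bound. -/
def vasquezNumber (G : Type) [Group G] : ℕ :=
  sInf {N : ℕ | IsVasquezBound G N}

/-! ### Aspherical Kähler groups and the complex Vasquez number -/

/-- The group of translations of `ℂⁿ` by the vectors of a subgroup `Λ` of `ℂⁿ`. -/
def translationGroup {n : ℕ} (Λ : Submodule ℤ (Fin n → ℂ)) :
    Subgroup (Equiv.Perm (Fin n → ℂ)) where
  carrier := {e | ∃ v ∈ Λ, ∀ z, e z = z + v}
  one_mem' := ⟨0, Λ.zero_mem, fun z => by simp⟩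
  mul_mem' := by
    rintro a b ⟨v, hv, ha⟩ ⟨w, hw, hb⟩
    exact ⟨w + v, Λ.add_mem hw hv, fun z => by simp [ha, hb, add_assoc]⟩
  inv_mem' := by
    rintro a ⟨v, hv, ha⟩
    refine ⟨-v, Λ.neg_mem hv, fun z => ?_⟩
    rw [Equiv.Perm.inv_eq_iff_eq, ha]
    simp

/-- `Δ` is a group of biholomorphisms of `ℂⁿ` that acts freely and contains the translations by a
full lattice `Λ` as a normal subgroup of finite index. Equivalently, the finite group `Δ / Λ` acts
freely and holomorphically on the compact complex torus `ℂⁿ / Λ`, and `Δ` is the group of deck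
transformations of the universal covering `ℂⁿ → (ℂⁿ / Λ) / (Δ / Λ) = ℂⁿ / Δ` of the generalized
hyperelliptic manifold `ℂⁿ / Δ`. -/
structure IsHyperellipticDeckGroup {n : ℕ} (Λ : Submodule ℤ (Fin n → ℂ))
    (Δ : Subgroup (Equiv.Perm (Fin n → ℂ))) : Prop where
  discrete : DiscreteTopology Λ
  span_eq_top : Submodule.span ℝ (Λ : Set (Fin n → ℂ)) = ⊤
  translations_le : translationGroup Λ ≤ Δ
  normal : ((translationGroup Λ).subgroupOf Δ).Normal
  finite : ((translationGroup Λ).subgroupOf Δ).FiniteIndex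
  holomorphic : ∀ γ ∈ Δ, Differentiable ℂ (γ : (Fin n → ℂ) → (Fin n → ℂ))
  free : ∀ γ ∈ Δ, ∀ z, γ z = z → γ = 1

/-- `Γ` is an aspherical Kähler group of (complex) dimension `n`: it is isomorphic to the
fundamental group (that is, the group of deck transformations of the universal covering) of an
`n`-dimensional generalized hyperelliptic manifold, i.e. of a quotient of a compact complex
`n`-torus by a free holomorphic action of a finite group. -/
def IsAsphericalKahlerGroup (Γ : Type) [Group Γ] (n : ℕ) : Prop :=
  ∃ (Λ : Submodule ℤ (Fin n → ℂ)) (Δ : Subgroup (Equiv.Perm (Fin n → ℂ))),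
    IsHyperellipticDeckGroup Λ Δ ∧ Nonempty (Γ ≃* Δ)

/-- `L` is the unique maximal abelian normal subgroup of `Γ`. -/
def IsMaxAbelianNormal {Γ : Type} [Group Γ] (L : Subgroup Γ) : Prop :=
  IsGreatest {A : Subgroup Γ | A.Normal ∧ ∀ x ∈ A, ∀ y ∈ A, x * y = y * x} L

/-- `N` is an admissible complex Vasquez bound for `G`: if `Γ` is an aspherical Kähler group with
maximal abelian normal subgroup `L` and holonomy group `Γ / L ≅ G`, then `L` contains a subgroup
`M`, normal in `Γ`, such that `Γ / M` is an aspherical Kähler group of complex dimension at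
most `N`. -/
def IsComplexVasquezBound (G : Type) [Group G] (N : ℕ) : Prop :=
  ∀ (Γ : Type) [Group Γ] (n : ℕ), IsAsphericalKahlerGroup Γ n →
    ∀ (L : Subgroup Γ) [L.Normal], IsMaxAbelianNormal L → Nonempty ((Γ ⧸ L) ≃* G) →
      ∃ (M : Subgroup Γ) (_ : M.Normal), M ≤ L ∧
        ∃ m ≤ N, IsAsphericalKahlerGroup (Γ ⧸ M) m

/-- The complex Vasquez number `n_ℂ(G)`: the smallest admissible complex Vasquez bound. -/
def complexVasquezNumber (G : Type) [Group G] : ℕ :=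
  sInf {N : ℕ | IsComplexVasquezBound G N}

/-! ### Characters, the Frobenius-Schur indicator and the Schur index -/

/-- The set of complex irreducible characters of `G`. -/
def irrChar (G : Type) [Group G] : Set (G → ℂ) :=
  {χ | ∃ (d : ℕ) (ρ : Representation ℂ G (Fin d → ℂ)), ρ.IsIrreducible ∧ ρ.character = χ}

/-- The Frobenius-Schur indicator `ν₂(χ) = |G|⁻¹ ∑ g, χ(g²)`. -/
def frobeniusSchurIndicator {G : Type} [Group G] [Fintype G] (χ : G → ℂ) : ℂ :=
  (1 / (Fintype.card G : ℂ)) * ∑ g : G, χ (g ^ 2)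

/-- The set of complex irreducible characters of `G` with Frobenius-Schur indicator `1`. -/
def irrCharOne (G : Type) [Group G] [Fintype G] : Set (G → ℂ) :=
  {χ | χ ∈ irrChar G ∧ frobeniusSchurIndicator χ = 1}

/-- The field of values `ℚ(χ)`, as a subfield of `ℂ`. -/
def characterField {G : Type} (χ : G → ℂ) : IntermediateField ℚ ℂ :=
  IntermediateField.adjoin ℚ (Set.range χ)

/-- The rational Schur index `m_ℚ(χ)` of an irreducible character `χ`: the smallest positive
integer `m` such that `m χ` is the character of a representation of `G` over `ℚ(χ)`. -/
def schurIndex {G : Type} [Group G] (χ : G → ℂ) : ℕ :=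
  sInf {m : ℕ | 0 < m ∧ ∃ (d : ℕ)
    (ρ : Representation (characterField χ) G (Fin d → characterField χ)),
      ∀ g, (ρ.character g : ℂ) = m * χ g}

end

/-! Everything is counted by pairs (c, χ), where c is an element of `G` and χ is a sign character
with χ(c) = 1. The pairs with c ≠ 1 number n(G), and all pairs together number 2 n_ℂ(G). The
difference is the number of characters, |G|. This is also the character sum, because every
irreducible character is a sign character with degree, indicator and Schur index 1.

For n(G), a class is special exactly when its value in the Tate group L^c / (1 + c)L is nonzero for
each c ≠ 1. Such a value is detected by a c-invariant integral functional that is odd on it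
(`exists_invariant_functional_odd`). Only the χ-components with χ(c) = 1 of this functional are
nonzero, so the common kernel of these components has corank at most the number of pairs and keeps
the class special (`IsElementaryTwo.isVasquezBound`). Conversely, on the sum of the lattices
ℤ[G/⟨c⟩] with c ≠ 1, any equivariant map to a torsion-free module that preserves specialness must
keep all the eigenvectors indexed by pairs independent (`linearIndependent_map_cosetEigenvector`).

For n_ℂ(G), Liouville's theorem makes deck transformations affine, so the same functionals live on
ℂⁿ (`IsHyperellipticDeckGroup.exists_linearPart`). A complex structure forces each isotypic
component to have even real dimension. The number of c ≠ 1 with χ(c) = 1 is odd because the rank is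
at least 2, so each character costs one more real dimension, which is the count of the pairs (1, χ).
The upper bound rebuilds a deck group from the chosen functionals
(`exists_hyperelliptic_of_crossedHom`). The lower bound applies the independence statement to an
explicit extension of `G` (`CosetExtension`). -/

/-! ### Sign characters of an elementary abelian 2-group -/

/-- `G` has exponent two and its elements are separated by its sign characters. -/
structure IsElementaryTwo (G : Type) [Group G] : Prop where
  mul_self : ∀ g : G, g * g = 1
  exists_char : ∀ g : G, g ≠ 1 → ∃ χ : G →* ℤˣ, χ g = -1

namespace IsElementaryTwo

variable {G : Type} [Group G]

theorem of_mulEquiv {k : ℕ} (e : G ≃* Multiplicative (Fin k → ZMod 2)) :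
    IsElementaryTwo G := by
  constructor
  · intro g
    apply e.injective
    rw [map_mul, map_one]
    apply Multiplicative.toAdd.injective
    rw [toAdd_mul, toAdd_one]
    ext i
    exact CharTwo.add_self_eq_zero _
  · intro g hg
    have h : ∃ i, (e g).toAdd i ≠ 0 := by
      by_contra! h
      apply hg
      apply e.injective
      rw [map_one]
      exact Multiplicative.toAdd.injective (funext h)
    obtain ⟨i, hi⟩ := h
    let f : Multiplicative (ZMod 2) →* ℤˣ :=
      { toFun := fun x => if x.toAdd = 0 then 1 else -1
        map_one' := by simp
        map_mul' := by decide }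
    refine ⟨(f.comp (AddMonoidHom.toMultiplicative
      (Pi.evalAddMonoidHom (fun _ : Fin k => ZMod 2) i))).comp e.toMonoidHom, ?_⟩
    exact if_neg hi

variable (h : IsElementaryTwo G)
include h

theorem comm (a b : G) : a * b = b * a := by
  have h1 := h.mul_self (a * b)
  have ha : a⁻¹ = a := inv_eq_of_mul_eq_one_left (h.mul_self a)
  have hb : b⁻¹ = b := inv_eq_of_mul_eq_one_left (h.mul_self b)
  rw [← inv_eq_of_mul_eq_one_left h1, mul_inv_rev, ha, hb]

theorem inv_eq (a : G) : a⁻¹ = a := inv_eq_of_mul_eq_one_left (h.mul_self a)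

/-- A character negative on both elements is corrected by one that is negative on the product `c *
d`. Consequently ⟨c⟩ acts freely on the cosets of ⟨d⟩, in a way that a character sees. -/
theorem exists_char_ne {c d : G} (hc : c ≠ 1) (hcd : c ≠ d) :
    ∃ χ : G →* ℤˣ, χ c = -1 ∧ χ d = 1 := by
  obtain ⟨χ, hχ⟩ := h.exists_char c hc
  rcases Int.units_eq_one_or (χ d) with hd | hd
  · exact ⟨χ, hχ, hd⟩
  · by_cases hd1 : d = 1
    · subst hd1; simp at hd
    obtain ⟨ψ, hψ⟩ := h.exists_char (c * d) (fun e => hcd (by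
      rw [← h.inv_eq d]; exact eq_inv_of_mul_eq_one_left e))
    rw [map_mul] at hψ
    rcases Int.units_eq_one_or (ψ d) with hd' | hd'
    · rw [hd', mul_one] at hψ
      exact ⟨ψ, hψ, hd'⟩
    · rw [hd'] at hψ
      have : ψ c = 1 := by simpa using hψ
      exact ⟨χ * ψ, by simp [hχ, this], by simp [hd, hd']⟩

variable [Fintype (G →* ℤˣ)]

theorem sum_char_apply (g : G) (hg : g ≠ 1) : ∑ χ : G →* ℤˣ, ((χ g : ℤˣ) : ℤ) = 0 := by
  obtain ⟨ψ, hψ⟩ := h.exists_char g hg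
  have := Fintype.sum_equiv (Equiv.mulLeft ψ) (fun χ : G →* ℤˣ => (((ψ * χ) g : ℤˣ) : ℤ))
    (fun χ => ((χ g : ℤˣ) : ℤ)) (fun χ => rfl)
  simp only [MonoidHom.mul_apply, hψ, Units.val_neg, neg_mul,
    one_mul, Finset.sum_neg_distrib] at this
  omega

end IsElementaryTwo

/-! ### Orthogonality relations and the number of pairs (c, χ) -/

theorem sum_group_char_apply {G : Type} [Group G] [Fintype G] (χ : G →* ℤˣ) (hχ : χ ≠ 1) :
    ∑ g : G, ((χ g : ℤˣ) : ℤ) = 0 := by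
  have : ∃ g, χ g ≠ 1 := by
    by_contra! h
    exact hχ (MonoidHom.ext h)
  obtain ⟨g, hg⟩ := this
  have hg := (Int.units_eq_one_or (χ g)).resolve_left hg
  have := Fintype.sum_equiv (Equiv.mulLeft g) (fun x => ((χ (g * x) : ℤˣ) : ℤ))
    (fun x => ((χ x : ℤˣ) : ℤ)) (fun χ => rfl)
  simp only [map_mul, hg, Units.val_neg, neg_mul,
    one_mul, Finset.sum_neg_distrib] at this
  omega

theorem coe_sign_mul_self {G : Type} [Group G] (χ : G →* ℤˣ) (g : G) :
    ((χ g : ℤˣ) : ℤ) * ((χ g : ℤˣ) : ℤ) = 1 := by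
  rw [← Units.val_mul, Int.units_mul_self, Units.val_one]

theorem sum_group_char_mul {G : Type} [Group G] [Fintype G] [DecidableEq (G →* ℤˣ)]
    (χ ψ : G →* ℤˣ) :
    ∑ g : G, ((χ g : ℤˣ) : ℤ) * ((ψ g : ℤˣ) : ℤ) = if χ = ψ then (Fintype.card G : ℤ) else 0 := by
  split_ifs with h
  · subst h
    simp
  · have := sum_group_char_apply (χ * ψ) (fun e => h (by
      have : ψ * ψ = 1 := MonoidHom.ext fun g => Int.units_mul_self (ψ g)
      have h2 : χ * ψ = ψ * ψ := by rw [e, this]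
      exact mul_right_cancel h2))
    simpa using this

theorem two_mul_card_char_eq_one {G : Type} [Group G] [Fintype G] (χ : G →* ℤˣ) :
    2 * (Fintype.card {g : G // χ g = 1} : ℤ) =
      Fintype.card G + ∑ g : G, ((χ g : ℤˣ) : ℤ) := by
  classical
  have : ∀ g : G, 2 * (if χ g = 1 then (1 : ℤ) else 0) = 1 + ((χ g : ℤˣ) : ℤ) := by
    intro g
    rcases Int.units_eq_one_or (χ g) with h | h <;> simp [h]
  rw [Fintype.card_subtype, Finset.card_filter]
  push_cast
  rw [Finset.mul_sum, Finset.sum_congr rfl (fun g _ => this g), Finset.sum_add_distrib]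
  simp

/-- The pairs `(c, χ)` of an element and a sign character that is trivial on it. -/
abbrev AnnPair (G : Type) [Group G] := {p : G × (G →* ℤˣ) // p.2 p.1 = 1}

theorem card_annPair_eq_sum {G : Type} [Group G] [Fintype G] [Fintype (G →* ℤˣ)] :
    Nat.card (AnnPair G) = ∑ χ : G →* ℤˣ, Fintype.card {g : G // χ g = 1} := by
  let e : AnnPair G ≃ Σ χ : G →* ℤˣ, {g : G // χ g = 1} :=
    { toFun := fun p => ⟨p.1.2, p.1.1, p.2⟩
      invFun := fun q => ⟨(q.2.1, q.1), q.2.2⟩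
      left_inv := fun p => rfl
      right_inv := fun q => rfl }
  rw [Nat.card_congr e, Nat.card_eq_fintype_card, Fintype.card_sigma]

/-- The pairs `(c, χ)` of a nontrivial element and a sign character that is trivial on it. -/
abbrev AnnPairNe (G : Type) [Group G] := {p : G × (G →* ℤˣ) // p.1 ≠ 1 ∧ p.2 p.1 = 1}

namespace IsElementaryTwo

variable {G : Type} [Group G] [Fintype G] [Fintype (G →* ℤˣ)] (h : IsElementaryTwo G)
include h

/-- Double counting of the sum of χ(g) over all g and χ: only g = 1 contributes in one order, only χ
= 1 in the other. -/
theorem card_char : Fintype.card (G →* ℤˣ) = Fintype.card G := by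
  classical
  have h1 : ∑ g : G, ∑ χ : G →* ℤˣ, ((χ g : ℤˣ) : ℤ) = Fintype.card (G →* ℤˣ) := by
    rw [Finset.sum_eq_single 1]
    · simp
    · intro g _ hg
      exact h.sum_char_apply g hg
    · simp
  have h2 : ∑ χ : G →* ℤˣ, ∑ g : G, ((χ g : ℤˣ) : ℤ) = Fintype.card G := by
    rw [Finset.sum_eq_single 1]
    · simp
    · intro χ _ hχ
      exact sum_group_char_apply χ hχ
    · simp
  rw [Finset.sum_comm, h2] at h1
  exact_mod_cast h1.symm

theorem card_annPair :
    2 * Fintype.card (AnnPair G) = Fintype.card G * Fintype.card G + Fintype.card G := by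
  classical
  have h2 : ∑ χ : G →* ℤˣ, ∑ g : G, ((χ g : ℤˣ) : ℤ) = Fintype.card G := by
    rw [Finset.sum_eq_single 1]
    · simp
    · intro χ _ hχ
      exact sum_group_char_apply χ hχ
    · simp
  have : (2 * Fintype.card (AnnPair G) : ℤ) =
      Fintype.card G * Fintype.card G + Fintype.card G := by
    rw [← Nat.card_eq_fintype_card, card_annPair_eq_sum]
    push_cast
    rw [Finset.mul_sum, Finset.sum_congr rfl (fun χ _ => two_mul_card_char_eq_one χ),
      Finset.sum_add_distrib, h2]
    simp [h.card_char]
  exact_mod_cast this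

theorem card_annPairNe [DecidableEq G] :
    Fintype.card (AnnPairNe G) + Fintype.card G = Fintype.card (AnnPair G) := by
  classical
  rw [← h.card_char]
  let e : AnnPairNe G ⊕ (G →* ℤˣ) ≃ AnnPair G :=
    { toFun := Sum.elim (fun p => ⟨p.1, p.2.2⟩) (fun χ => ⟨(1, χ), map_one χ⟩)
      invFun := fun p => if hp : p.1.1 = 1 then Sum.inr p.1.2 else Sum.inl ⟨p.1, hp, p.2⟩
      left_inv := by
        rintro (p | χ)
        · simp [p.2.1]
        · simp
      right_inv := by
        rintro ⟨⟨c, χ⟩, hp⟩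
        by_cases hc : c = 1
        · subst hc; simp
        · simp [hc] }
  rw [← Fintype.card_congr e, Fintype.card_sum]

end IsElementaryTwo

/-- The kernel of χ has order |G| or |G|/2. This is where rank at least 2 enters the parity
argument. -/
theorem even_card_char_eq_one {G : Type} [Group G] [Fintype G] (h4 : 4 ∣ Fintype.card G)
    (χ : G →* ℤˣ) : Even (Fintype.card {g : G // χ g = 1}) := by
  have h1 := two_mul_card_char_eq_one χ
  by_cases hχ : χ = 1
  · subst hχ
    simp only [MonoidHom.one_apply, Units.val_one, Finset.sum_const, Finset.card_univ,
      nsmul_eq_mul, mul_one] at h1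
    rw [Nat.even_iff]
    simp only [MonoidHom.one_apply]
    omega
  · rw [sum_group_char_apply χ hχ] at h1
    rw [Nat.even_iff]
    omega

theorem card_ne_one_char_eq_one {G : Type} [Group G] [Fintype G] [DecidableEq G] (χ : G →* ℤˣ) :
    Fintype.card {g : G // g ≠ 1 ∧ χ g = 1} + 1 = Fintype.card {g : G // χ g = 1} := by
  have : (Finset.univ.filter fun g : G => g ≠ 1 ∧ χ g = 1) =
      (Finset.univ.filter fun g : G => χ g = 1).erase 1 := by
    ext g; simp
  rw [Fintype.card_subtype, Fintype.card_subtype, this, Finset.card_erase_add_one]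
  simp

/-! ### Complex characters and Schur indices -/

/-- The one-dimensional representation over `K` afforded by a sign character. -/
def signRepresentation (K : Type) [Field K] {G : Type} [Group G] (χ : G →* ℤˣ) :
    Representation K G (Fin 1 → K) where
  toFun g := ((χ g : ℤˣ) : ℤ) • (LinearMap.id : (Fin 1 → K) →ₗ[K] (Fin 1 → K))
  map_one' := by ext; simp
  map_mul' a b := by
    ext
    simp [mul_smul]

theorem signRepresentation_character (K : Type) [Field K] {G : Type} [Group G] (χ : G →* ℤˣ)
    (g : G) : (signRepresentation K χ).character g = (((χ g : ℤˣ) : ℤ) : K) := by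
  change LinearMap.trace K _ (((χ g : ℤˣ) : ℤ) •
    (LinearMap.id : (Fin 1 → K) →ₗ[K] (Fin 1 → K))) = _
  rw [map_zsmul, LinearMap.trace_id]
  simp

theorem signRepresentation_isIrreducible {G : Type} [Group G] (χ : G →* ℤˣ) :
    (signRepresentation ℂ χ).IsIrreducible := by
  have hs : IsSimpleOrder (Submodule ℂ (Fin 1 → ℂ)) :=
    isSimpleModule_iff ℂ _ |>.1 (isSimpleModule_iff_finrank_eq_one.2 (by simp))
  exact
    { exists_pair_ne := ⟨⊥, ⊤, fun e => bot_ne_top (α := Submodule ℂ (Fin 1 → ℂ))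
        (congrArg Subrepresentation.toSubmodule e)⟩
      eq_bot_or_eq_top := fun a => (hs.eq_bot_or_eq_top a.toSubmodule).imp
        (fun e => Subrepresentation.toSubmodule_injective e)
        (fun e => Subrepresentation.toSubmodule_injective e) }

/-- The complex-valued function underlying a sign character. -/
def complexSign {G : Type} [Group G] (χ : G →* ℤˣ) : G → ℂ := fun g => (((χ g : ℤˣ) : ℤ) : ℂ)

theorem complexSign_injective {G : Type} [Group G] :
    Function.Injective (complexSign (G := G)) := by
  intro χ ψ h
  ext g
  have := congrFun h g
  simpa [complexSign] using this

theorem complexSign_mem_irrChar {G : Type} [Group G] (χ : G →* ℤˣ) :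
    complexSign χ ∈ irrChar G :=
  ⟨1, signRepresentation ℂ χ, signRepresentation_isIrreducible χ,
    funext fun g => signRepresentation_character ℂ χ g⟩

/-- Commutativity makes irreducible representations one-dimensional, and exponent two forces the
resulting multiplicative character to take values ±1. -/
theorem IsElementaryTwo.irrChar_eq {G : Type} [Group G] (h : IsElementaryTwo G) :
    irrChar G = Set.range (complexSign (G := G)) := by
  refine Set.Subset.antisymm ?_ (Set.range_subset_iff.2 complexSign_mem_irrChar)
  rintro _ ⟨d, ρ, hρ, rfl⟩
  have : IsMulCommutative G := ⟨⟨h.comm⟩⟩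
  have hd := Representation.IsIrreducible.finrank_eq_one_of_isMulCommutative (ρ := ρ)
  simp only [Module.finrank_fintype_fun_eq_card, Fintype.card_fin] at hd
  subst hd
  have key : ∀ f : (Fin 1 → ℂ) →ₗ[ℂ] (Fin 1 → ℂ), f = (f 1 0) • LinearMap.id := by
    intro f
    apply LinearMap.pi_ext'
    intro i
    fin_cases i
    ext j
    fin_cases j
    have : (Pi.single 0 1 : Fin 1 → ℂ) = 1 := by ext i; fin_cases i; simp
    simp [this]
  have htr : ∀ g, ρ.character g = (ρ g 1 0) := by
    intro g
    change LinearMap.trace ℂ _ (ρ g) = _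
    rw [key (ρ g), map_smul, LinearMap.trace_id]
    simp
  have hmul : ∀ a b, ρ.character (a * b) = ρ.character a * ρ.character b := by
    intro a b
    rw [htr, htr, htr, map_mul, Module.End.mul_apply]
    conv_lhs => rw [key (ρ a)]
    simp
  have hone : ρ.character 1 = 1 := by rw [htr, map_one ρ]; rfl
  have hsq : ∀ g, ρ.character g = 1 ∨ ρ.character g = -1 := by
    intro g
    rw [← mul_self_eq_one_iff, ← hmul, h.mul_self, hone]
  classical
  have hne : (-1 : ℂ) ≠ 1 := by norm_num
  refine ⟨{ toFun := fun g => if ρ.character g = 1 then 1 else -1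
            map_one' := by simp [hone]
            map_mul' := fun a b => ?_ }, ?_⟩
  · rw [hmul]
    rcases hsq a with ha | ha <;> rcases hsq b with hb | hb <;> simp [ha, hb, hne]
  · funext g
    rcases hsq g with hg | hg <;> simp [complexSign, hg, hne]

theorem schurIndex_complexSign {G : Type} [Group G] (χ : G →* ℤˣ) :
    schurIndex (complexSign χ) = 1 := by
  refine le_antisymm (Nat.sInf_le ⟨one_pos, 1, signRepresentation _ χ, fun g => ?_⟩)
    (le_csInf ⟨1, one_pos, 1, signRepresentation _ χ, fun g => ?_⟩ fun m hm => hm.1)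
  all_goals
    rw [signRepresentation_character]
    simp [complexSign]

theorem IsElementaryTwo.sum_schurIndex {G : Type} [Group G] [Fintype G]
    (h : IsElementaryTwo G) :
    ∑ᶠ χ ∈ irrCharOne G, (schurIndex χ : ℂ) * χ 1 = Fintype.card G := by
  have hset : irrCharOne G = Set.range (complexSign (G := G)) := by
    rw [irrCharOne, h.irrChar_eq]
    refine Set.Subset.antisymm (fun χ hχ => hχ.1) ?_
    rintro _ ⟨χ, rfl⟩
    refine ⟨⟨χ, rfl⟩, ?_⟩
    have : ∀ g : G, complexSign χ (g ^ 2) = 1 := fun g => by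
      rw [pow_two, h.mul_self]; simp [complexSign]
    rw [frobeniusSchurIndicator, Finset.sum_congr rfl (fun g _ => this g)]
    simp
  have := Fintype.ofFinite (G →* ℤˣ)
  rw [hset, finsum_mem_range complexSign_injective, finsum_eq_sum_of_fintype, ← h.card_char]
  simp [schurIndex_complexSign, complexSign]

open CategoryTheory groupCohomology

/-! ### Special classes -/

theorem map_H2π {G H : Type} [Group G] [Group H] {A : Rep ℤ H} {B : Rep ℤ G} (f : G →* H)
    (φ : Rep.res f A ⟶ B) (σ : cocycles₂ A) :
    (groupCohomology.map f φ 2).hom (H2π A σ) = H2π B (mapCocycles₂ f φ σ) :=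
  congrArg (fun F => F.hom σ) (H2π_comp_map (A := A) (B := B) f φ)

theorem exists_H2π_eq {G : Type} [Group G] {A : Rep ℤ G} (α : groupCohomology A 2) :
    ∃ σ : cocycles₂ A, H2π A σ = α :=
  H2_induction_on (C := fun α => ∃ σ : cocycles₂ A, H2π A σ = α) α fun σ => ⟨σ, rfl⟩

theorem res_H2π_eq_zero_iff {G : Type} [Group G] (A : Rep ℤ G) (σ : cocycles₂ A)
    (H : Subgroup G) :
    (groupCohomology.map H.subtype (𝟙 (Rep.res H.subtype A)) 2).hom (H2π A σ) = 0 ↔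
      ∃ x : H → A, ∀ a b : H, A.ρ a (x b) - x (a * b) + x a = σ (a, b) := by
  rw [map_H2π, H2π_eq_zero_iff]
  constructor
  · rintro ⟨x, hx⟩
    exact ⟨x, fun a b => congrFun hx (a, b)⟩
  · rintro ⟨x, hx⟩
    exact ⟨x, funext fun p => hx p.1 p.2⟩

/-- A class is special if and only if it restricts to a nonzero class on every subgroup of order
two, which can be read off from the Tate cohomology group `A^c / (1 + c) A`. -/
theorem isSpecial_H2π_iff {G : Type} [Group G] (hG : IsElementaryTwo G) (A : Rep ℤ G)
    (σ : cocycles₂ A) :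
    IsSpecial A (H2π A σ) ↔ ∀ c : G, c ≠ 1 → ∀ y : A, y + A.ρ c y ≠ σ (c, c) + σ (1, 1) := by
  constructor
  · intro h c hc y hy
    refine h (Subgroup.zpowers c) (by simpa using hc) ?_
    rw [res_H2π_eq_zero_iff]
    classical
    have hmem : ∀ a : Subgroup.zpowers c, a = 1 ∨ (a : G) = c := by
      rintro ⟨a, n, rfl⟩
      have h2 : c ^ 2 = 1 := by rw [pow_two, hG.mul_self]
      rcases Int.even_or_odd' n with ⟨m, rfl | rfl⟩
      · left; ext; simp [zpow_mul, h2]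
      · right; simp [zpow_add, zpow_mul, h2]
    have hcH : c ∈ Subgroup.zpowers c := Subgroup.mem_zpowers c
    refine ⟨fun a => if a = 1 then σ (1, 1) else y, fun a b => ?_⟩
    rcases hmem a with rfl | ha <;> rcases hmem b with rfl | hb
    · simp
    · simp [cocycles₂_map_one_fst σ (b : G)]
    · simp [cocycles₂_map_one_snd σ (a : G)]
    · have ha' : a = ⟨c, hcH⟩ := Subtype.ext ha
      have hb' : b = ⟨c, hcH⟩ := Subtype.ext hb
      subst ha' hb'
      have h1 : (⟨c, hcH⟩ : Subgroup.zpowers c) ≠ 1 := fun e => hc (congrArg Subtype.val e)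
      have h2 : (⟨c, hcH⟩ * ⟨c, hcH⟩ : Subgroup.zpowers c) = 1 :=
        Subtype.ext (hG.mul_self c)
      simp only [h2, if_neg h1, if_true]
      rw [sub_add_eq_add_sub, add_comm, sub_eq_iff_eq_add, hy]
  · intro h H hH h0
    rw [res_H2π_eq_zero_iff] at h0
    obtain ⟨x, hx⟩ := h0
    obtain ⟨c, hc⟩ : ∃ c : H, c ≠ 1 := by
      by_contra! hall
      exact hH ((Subgroup.eq_bot_iff_forall H).2 fun a ha => congrArg Subtype.val (hall ⟨a, ha⟩))
    refine h c (fun e => hc (Subtype.ext e)) (x c) ?_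
    have h1 := hx 1 1
    have h2 := hx c c
    have hcc : c * c = 1 := Subtype.ext (hG.mul_self c)
    rw [hcc] at h2
    simp only [OneMemClass.coe_one, map_one, Module.End.one_apply, mul_one, sub_self, zero_add]
      at h1
    rw [← h1, ← h2]
    abel

/-! ### Invariant functionals detecting a Tate class, and their isotypic components -/

/-- Let T = 1 + c be the norm, so Tw = 2w. If every coordinate of Tw in a basis of the range of T
were even, then 2w = 2Ty for some y, and w would be a norm. A coordinate that is odd on Tw gives the
functional after composition with T, which absorbs c. -/
theorem exists_invariant_functional_odd {L : Type} [AddCommGroup L] [Module.Free ℤ L]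
    [Module.Finite ℤ L] (c : L →ₗ[ℤ] L) (hc : ∀ x, c (c x) = x) {w : L} (hw : c w = w)
    (hn : ∀ y, y + c y ≠ w) :
    ∃ f : L →ₗ[ℤ] ℤ, (∀ x, f (c x) = f x) ∧ Odd (f w) := by
  let T : L →ₗ[ℤ] L := LinearMap.id + c
  have hT : ∀ x, T x = x + c x := fun x => rfl
  let b := Module.Free.chooseBasis ℤ (LinearMap.range T)
  by_cases h : ∃ i, Odd (b.repr (T.rangeRestrict w) i)
  · obtain ⟨i, hi⟩ := h
    refine ⟨b.coord i ∘ₗ T.rangeRestrict, fun x => ?_, hi⟩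
    have : T.rangeRestrict (c x) = T.rangeRestrict x := by
      ext
      simp only [LinearMap.codRestrict_apply, LinearMap.rangeRestrict, hT, hc, add_comm]
    simp only [LinearMap.comp_apply, this]
  · exfalso
    simp only [not_exists, Int.not_odd_iff_even] at h
    choose m hm using fun i => (h i).two_dvd
    obtain ⟨y, hy⟩ := (∑ i, m i • b i : LinearMap.range T).2
    have h2 : T.rangeRestrict w = (2 : ℤ) • ∑ i, m i • b i := by
      rw [← b.sum_repr (T.rangeRestrict w), Finset.smul_sum]
      exact Finset.sum_congr rfl fun i _ => by rw [hm, mul_smul]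
    have h3 : (2 : ℤ) • w = (2 : ℤ) • T y := by
      have := congrArg Subtype.val h2
      rw [Submodule.coe_smul, ← hy] at this
      rw [← this]
      change _ = w + c w
      rw [hw, two_smul]
    have : IsAddTorsionFree L := Module.isTorsionFree_int_iff_isAddTorsionFree.1 inferInstance
    exact hn y (smul_right_injective L (two_ne_zero' ℤ) h3).symm

section Twist

variable {R V G : Type} [CommRing R] [AddCommGroup V] [Module R V] [Group G] [Fintype G]
  (ρ : Representation R G V) (χ : G →* ℤˣ) (f : V →ₗ[R] R)

/-- The unnormalised projection of a functional to its `χ`-isotypic component. -/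
def twistedSum : V →ₗ[R] R := ∑ g : G, ((χ g : ℤˣ) : ℤ) • (f ∘ₗ ρ g)

theorem twistedSum_apply (x : V) :
    twistedSum ρ χ f x = ∑ g : G, ((χ g : ℤˣ) : ℤ) • f (ρ g x) := by
  simp [twistedSum]

theorem twistedSum_apply_rho (h : G) (x : V) :
    twistedSum ρ χ f (ρ h x) = ((χ h : ℤˣ) : ℤ) • twistedSum ρ χ f x := by
  rw [twistedSum_apply, twistedSum_apply, Finset.smul_sum]
  refine Fintype.sum_equiv (Equiv.mulRight h) _ _ fun g => ?_
  simp only [Equiv.coe_mulRight, map_mul, Units.val_mul, Module.End.mul_apply, smul_smul]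
  congr 1
  rw [mul_comm, mul_assoc, coe_sign_mul_self, mul_one]

theorem twistedSum_of_eigen (hf : ∀ g x, f (ρ g x) = ((χ g : ℤˣ) : ℤ) • f x) (x : V) :
    twistedSum ρ χ f x = (Fintype.card G : ℤ) • f x := by
  rw [twistedSum_apply]
  simp only [hf, smul_smul, coe_sign_mul_self, one_smul]
  simp

/-- Reindexing the sum by translation with c multiplies it by χ(c) = -1. -/
theorem twistedSum_eq_zero [IsAddTorsionFree R] {c : G} (hc : ∀ x, f (ρ c x) = f x)
    (hχ : χ c ≠ 1) : twistedSum ρ χ f = 0 := by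
  have hχ := (Int.units_eq_one_or (χ c)).resolve_left hχ
  ext x
  have h : twistedSum ρ χ f x = - twistedSum ρ χ f x := by
    nth_rw 1 [twistedSum_apply]
    rw [twistedSum_apply, ← Finset.sum_neg_distrib]
    symm
    refine Fintype.sum_equiv (Equiv.mulLeft c) _ _ fun g => ?_
    simp [hc, hχ]
  exact self_eq_neg.1 h

theorem sum_twistedSum (hG : IsElementaryTwo G) [Fintype (G →* ℤˣ)] (x : V) :
    ∑ χ : G →* ℤˣ, twistedSum ρ χ f x = (Fintype.card G : ℤ) • f x := by
  simp only [twistedSum_apply]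
  rw [Finset.sum_comm]
  simp only [← Finset.sum_smul]
  rw [Finset.sum_eq_single 1]
  · simp [hG.card_char]
  · intro g _ hg
    rw [hG.sum_char_apply g hg, zero_smul]
  · simp

/-- |G| f is the sum of its isotypic components, and c-invariance kills those with χ(c) ≠ 1. Hence
the pairs with χ(c) = 1 suffice to control f. -/
theorem eq_zero_of_twistedSum [IsAddTorsionFree R] (hG : IsElementaryTwo G) {c : G}
    (hc : ∀ x, f (ρ c x) = f x) {x : V}
    (h : ∀ χ : G →* ℤˣ, χ c = 1 → twistedSum ρ χ f x = 0) : f x = 0 := by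
  have := Fintype.ofFinite (G →* ℤˣ)
  have hsum := sum_twistedSum ρ f hG x
  rw [Finset.sum_eq_zero, zsmul_eq_mul] at hsum
  · rw [← zsmul_eq_mul, eq_comm, smul_eq_zero_iff_right (by exact_mod_cast Fintype.card_ne_zero)]
      at hsum
    exact hsum
  · intro χ _
    by_cases hχ : χ c = 1
    · exact h χ hχ
    · rw [twistedSum_eq_zero ρ χ f hc hχ]; rfl

end Twist

/-! ### The upper bound for the Vasquez number -/

/-- This is the cocycle identity at (c, c, c); it makes the element a representative of a Tate
class. -/
theorem IsElementaryTwo.rho_cocycle_diag {G : Type} [Group G] (hG : IsElementaryTwo G)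
    {A : Rep ℤ G} (σ : cocycles₂ A) (c : G) :
    A.ρ c (σ (c, c) + σ (1, 1)) = σ (c, c) + σ (1, 1) := by
  have h := (mem_cocycles₂_iff (σ : G × G → A)).1 σ.2 c c c
  rw [hG.mul_self, cocycles₂_map_one_fst σ c, cocycles₂_map_one_snd σ c] at h
  rw [map_add, ← h, add_comm]

theorem IsElementaryTwo.isVasquezBound {G : Type} [Group G] [Fintype G]
    (hG : IsElementaryTwo G) : IsVasquezBound G (Nat.card (AnnPairNe G)) := by
  intro L _ _ _ ρ _ α hα
  obtain ⟨σ, rfl⟩ := exists_H2π_eq α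
  rw [isSpecial_H2π_iff hG] at hα
  have hρ : ∀ c x, ρ c (ρ c x) = x := fun c x => by
    rw [← Module.End.mul_apply, ← map_mul, hG.mul_self, map_one]; rfl
  choose f hf1 hf2 using fun (c : G) (hc : c ≠ 1) =>
    exists_invariant_functional_odd (ρ c) (hρ c) (hG.rho_cocycle_diag σ c) (hα c hc)
  have := Fintype.ofFinite (AnnPairNe G)
  let Φ : L →ₗ[ℤ] (AnnPairNe G → ℤ) :=
    LinearMap.pi fun p => twistedSum ρ p.1.2 (f p.1.1 p.2.1)
  have hΦ : ∀ x p, Φ x p = twistedSum ρ p.1.2 (f p.1.1 p.2.1) x := fun x p => rfl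
  have hW : ∀ g, LinearMap.ker Φ ≤ (LinearMap.ker Φ).comap (ρ g) := by
    intro g x hx
    simp only [Submodule.mem_comap, LinearMap.mem_ker] at hx ⊢
    funext p
    rw [hΦ, twistedSum_apply_rho, ← hΦ, hx]
    simp
  refine ⟨LinearMap.ker Φ, hW, ?_, ?_, ?_⟩
  · intro m x hm hx
    simp only [LinearMap.mem_ker, map_smul] at hx ⊢
    exact (smul_eq_zero.1 hx).resolve_left hm
  · rw [Φ.quotKerEquivRange.finrank_eq, Nat.card_eq_fintype_card,
      ← Module.finrank_fintype_fun_eq_card ℤ]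
    exact Submodule.finrank_le _
  · rw [map_H2π, isSpecial_H2π_iff hG]
    intro c hc y hy
    obtain ⟨y, rfl⟩ := Submodule.mkQ_surjective _ y
    -- If the image of the class were a norm, `f c` would take the same value on the class as on a
    -- norm, because it vanishes on the kernel of `Φ`. It is odd on the class and even on norms.
    have hmem : y + ρ c y - (σ (c, c) + σ (1, 1)) ∈ LinearMap.ker Φ :=
      (Submodule.Quotient.eq _).1 hy
    have h0 : f c hc (y + ρ c y - (σ (c, c) + σ (1, 1))) = 0 :=
      eq_zero_of_twistedSum ρ (f c hc) hG (hf1 c hc) fun χ hχ =>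
        congrFun (LinearMap.mem_ker.1 hmem) ⟨(c, χ), hc, hχ⟩
    rw [map_sub, sub_eq_zero, map_add (f c hc) y, hf1] at h0
    have := hf2 c hc
    rw [← h0, ← Int.not_even_iff_odd] at this
    exact this ⟨_, rfl⟩

/-! ### The lattice of functions invariant under cyclic subgroups -/

section CosetLattice

variable {G : Type} [Group G]

/-- The direct sum over `c ∈ S` of the lattices `ℤ[G / ⟨c⟩]`, realised as families of functions
on `G` whose component at `c` is invariant under `c`. -/
def cosetLattice (S : Set G) : Submodule ℤ (G → G → ℤ) where
  carrier := {f | (∀ c g, f c (g * c) = f c g) ∧ ∀ c ∉ S, f c = 0}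
  zero_mem' := ⟨fun _ _ => rfl, fun _ _ => rfl⟩
  add_mem' := by
    rintro f f' ⟨h1, h2⟩ ⟨h1', h2'⟩
    exact ⟨fun c g => by simp [h1, h1'], fun c hc => by simp [h2 c hc, h2' c hc]⟩
  smul_mem' := by
    rintro m f ⟨h1, h2⟩
    exact ⟨fun c g => by simp [h1], fun c hc => by simp [h2 c hc]⟩

/-- The action of `G` on `cosetLattice S` by translation. -/
def cosetRep (hG : IsElementaryTwo G) (S : Set G) : Representation ℤ G (cosetLattice S) where
  toFun h :=
    { toFun := fun f => ⟨fun c g => f.1 c (g * h), fun c g => by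
        change f.1 c (g * c * h) = f.1 c (g * h)
        rw [mul_assoc, hG.comm c h, ← mul_assoc, f.2.1], fun c hc => by
        funext g; simp [f.2.2 c hc]⟩
      map_add' := fun _ _ => rfl
      map_smul' := fun _ _ => rfl }
  map_one' := by ext; simp
  map_mul' a b := by ext; simp [mul_assoc]

@[simp]
theorem cosetRep_apply (hG : IsElementaryTwo G) (S : Set G) (h : G) (f : cosetLattice S)
    (c g : G) : (cosetRep hG S h f).1 c g = f.1 c (g * h) := rfl

open Classical in
/-- The sign character `χ`, trivial on `c`, as an element of the component of `cosetLattice S`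
at `c`. -/
noncomputable def cosetEigenvector {S : Set G} (c : G) (χ : G →* ℤˣ) (hc : c ∈ S) (hχ : χ c = 1) :
    cosetLattice S :=
  ⟨fun d g => if d = c then ((χ g : ℤˣ) : ℤ) else 0, fun d g => by
    by_cases h : d = c
    · subst h; simp [hχ]
    · simp [h], fun d hd => by
    have : d ≠ c := fun e => hd (e ▸ hc)
    funext g; simp [this]⟩

open Classical in
@[simp]
theorem cosetEigenvector_apply {S : Set G} (c : G) (χ : G →* ℤˣ) (hc : c ∈ S) (hχ : χ c = 1)
    (d g : G) : (cosetEigenvector c χ hc hχ).1 d g = if d = c then ((χ g : ℤˣ) : ℤ) else 0 := rfl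

theorem cosetRep_cosetEigenvector (hG : IsElementaryTwo G) {S : Set G} (c : G) (χ : G →* ℤˣ)
    (hc : c ∈ S) (hχ : χ c = 1) (h : G) :
    cosetRep hG S h (cosetEigenvector c χ hc hχ) =
      ((χ h : ℤˣ) : ℤ) • cosetEigenvector c χ hc hχ := by
  ext d g
  by_cases hd : d = c <;> simp [hd, mul_comm]

open Classical in
/-- The indicator function of the nontrivial coset of the kernel of a sign character that is
nontrivial on `c`; it is zero for `c = 1`. -/
noncomputable def indicator (hG : IsElementaryTwo G) (c g : G) : ℤ :=
  if hc : c ≠ 1 then if (hG.exists_char c hc).choose g = 1 then 0 else 1 else 0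

theorem indicator_self (hG : IsElementaryTwo G) {c : G} (hc : c ≠ 1) : indicator hG c c = 1 := by
  simp [indicator, hc, (hG.exists_char c hc).choose_spec]

@[simp]
theorem indicator_one_left (hG : IsElementaryTwo G) (g : G) : indicator hG 1 g = 0 := by
  simp [indicator]

@[simp]
theorem indicator_one_right (hG : IsElementaryTwo G) (c : G) : indicator hG c 1 = 0 := by
  simp [indicator]

theorem indicator_mul (hG : IsElementaryTwo G) (c g h : G) :
    indicator hG c (g * h) =
      indicator hG c g + indicator hG c h - 2 * (indicator hG c g * indicator hG c h) := by
  by_cases hc : c = 1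
  · simp [hc]
  · simp only [indicator, ne_eq, hc, not_false_eq_true, dif_pos]
    set ψ := (hG.exists_char c hc).choose
    rcases Int.units_eq_one_or (ψ g) with h1 | h1 <;>
      rcases Int.units_eq_one_or (ψ h) with h2 | h2 <;> simp [h1, h2]

/-- The elements of `cosetLattice S` that are constant on each component. -/
noncomputable def cosetConst {S : Set G} (hS : ∀ c ≠ 1, c ∈ S) (u : G → ℤ) (hu : u 1 = 0) :
    cosetLattice S :=
  ⟨fun c _ => u c, fun _ _ => rfl, fun c hc => by
    have : c = 1 := by_contra fun h => hc (hS c h)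
    funext g; simp [this, hu]⟩

/-- The cocycle whose component at `c` is the image under the norm map of the pull-back of the
generator of `H²(ℤ/2, ℤ)` along a sign character nontrivial on `c`. -/
noncomputable def cosetCocycle (hG : IsElementaryTwo G) {S : Set G} (hS : ∀ c ≠ 1, c ∈ S) (g h : G) :
    cosetLattice S :=
  cosetConst hS (fun c => indicator hG c g * indicator hG c h) (by simp)

@[simp]
theorem cosetCocycle_apply (hG : IsElementaryTwo G) {S : Set G} (hS : ∀ c ≠ 1, c ∈ S)
    (g h c x : G) :
    (cosetCocycle hG hS g h).1 c x = indicator hG c g * indicator hG c h := rfl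

/-- In the component at c ≠ d, the subgroup ⟨d⟩ acts freely on the cosets of ⟨c⟩, so restricting u
to a half of `G` exchanged with the other by d gives a preimage under the norm. In the component at
d the action of d is trivial and the norm is doubling, hence the evenness hypothesis. -/
theorem exists_add_cosetRep_eq (hG : IsElementaryTwo G) {S : Set G} (u : cosetLattice S) {d : G}
    (hd : d ≠ 1) (hu : ∀ c g, u.1 c (g * d) = u.1 c g)
    (heven : ∀ g, Even (u.1 d g)) : ∃ y, y + cosetRep hG S d y = u := by
  classical
  choose m hm using heven
  have key : ∀ c, ∃ y : G → ℤ, (∀ g, y (g * c) = y g) ∧ (u.1 c = 0 → y = 0) ∧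
      ∀ g, y g + y (g * d) = u.1 c g := by
    intro c
    by_cases hcd : c = d
    · subst hcd
      refine ⟨m, fun g => ?_, fun h => funext fun g => ?_, fun g => ?_⟩
      · have := hu c g
        rw [hm, hm] at this
        omega
      · have := congrFun h g
        rw [hm] at this
        change m g = 0
        change m g + m g = 0 at this
        omega
      · have := hu c g
        rw [hm, hm] at this
        rw [hm]
        omega
    · obtain ⟨b, hb1, hb2⟩ := hG.exists_char_ne hd (Ne.symm hcd)
      refine ⟨fun g => if b g = 1 then u.1 c g else 0, fun g => ?_, fun h => ?_, fun g => ?_⟩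
      · simp [hb2, u.2.1]
      · funext g; simp [h]
      · rcases Int.units_eq_one_or (b g) with h | h <;> simp [h, hb1, hu]
  choose y hy1 hy2 hy3 using key
  exact ⟨⟨fun c g => y c g, fun c g => hy1 c g, fun c hc => hy2 c (u.2.2 c hc)⟩,
    Subtype.ext (funext fun c => funext fun g => hy3 c g)⟩

/-- If an equivariant map from `cosetLattice S` to a torsion-free module does not kill any of the
local classes, then it is injective on the span of the eigenvectors. -/
theorem linearIndependent_map_cosetEigenvector (hG : IsElementaryTwo G) [Fintype G] {S : Set G}
    (hS : ∀ c ≠ 1, c ∈ S) {Q : Type} [AddCommGroup Q] [Module.IsTorsionFree ℤ Q]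
    (ρ : Representation ℤ G Q) (ψ : cosetLattice S →ₗ[ℤ] Q)
    (hψ : ∀ g x, ψ (cosetRep hG S g x) = ρ g (ψ x))
    (hne : ∀ c ≠ 1, ∀ y, ψ (y + cosetRep hG S c y) ≠ ψ (cosetCocycle hG hS c c)) :
    LinearIndependent ℤ fun p : AnnPairNe G =>
      ψ (cosetEigenvector p.1.1 p.1.2 (hS _ p.2.1) p.2.2) := by
  classical
  have := Fintype.ofFinite (AnnPairNe G)
  set v : AnnPairNe G → cosetLattice S :=
    fun p => cosetEigenvector p.1.1 p.1.2 (hS _ p.2.1) p.2.2 with hv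
  have hρv : ∀ g p, ρ g (ψ (v p)) = ((p.1.2 g : ℤˣ) : ℤ) • ψ (v p) := fun g p => by
    rw [← hψ, hv, cosetRep_cosetEigenvector, map_smul]
  -- A relation splits by characters, so only eigenvectors with a common character have to be
  -- compared.
  have hblock : ∀ (a : AnnPairNe G → ℤ), ∑ p, a p • ψ (v p) = 0 → ∀ χ : G →* ℤˣ,
      ∑ p with p.1.2 = χ, a p • ψ (v p) = 0 := by
    intro a ha χ
    have h1 : ∑ g : G, ((χ g : ℤˣ) : ℤ) • ρ g (∑ p, a p • ψ (v p)) = 0 := by simp [ha]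
    simp only [map_sum, map_smul, hρv, Finset.smul_sum] at h1
    rw [Finset.sum_comm] at h1
    have h2 : ∀ p : AnnPairNe G, ∑ g : G, ((χ g : ℤˣ) : ℤ) • a p • ((p.1.2 g : ℤˣ) : ℤ) • ψ (v p)
        = (Fintype.card G : ℤ) • if p.1.2 = χ then a p • ψ (v p) else 0 := by
      intro p
      have : ∀ g : G, ((χ g : ℤˣ) : ℤ) • a p • ((p.1.2 g : ℤˣ) : ℤ) • ψ (v p)
          = (((p.1.2 g : ℤˣ) : ℤ) * ((χ g : ℤˣ) : ℤ)) • a p • ψ (v p) := fun g => by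
        simp only [smul_smul]
        congr 1
        ring
      rw [Finset.sum_congr rfl fun g _ => this g, ← Finset.sum_smul, sum_group_char_mul]
      split_ifs <;> simp
    rw [Finset.sum_congr rfl fun p _ => h2 p, ← Finset.smul_sum, ← Finset.sum_filter] at h1
    exact (smul_eq_zero.1 h1).resolve_left (by exact_mod_cast Fintype.card_ne_zero)
  rw [Fintype.linearIndependent_iff]
  intro a ha p₀
  by_contra hp₀
  set s : Finset (AnnPairNe G) := Finset.univ.filter fun p => p.1.2 = p₀.1.2 with hs
  have hp₀s : p₀ ∈ s := by simp [hs]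
  have hsum := hblock a ha p₀.1.2
  rw [← hs] at hsum
  -- The target is torsion-free, so the relation may be divided by the gcd of its coefficients. Some
  -- coefficient is then odd, and the local class at the corresponding c will be shown to die.
  obtain ⟨b, hb, hgcd⟩ := s.extract_gcd a ⟨p₀, hp₀s⟩
  have hg : s.gcd a ≠ 0 := fun h => hp₀ (Finset.gcd_eq_zero_iff.1 h p₀ hp₀s)
  have hsum' : ψ (∑ p ∈ s, b p • v p) = 0 := by
    have : s.gcd a • ψ (∑ p ∈ s, b p • v p) = 0 := by
      rw [← hsum, map_sum, Finset.smul_sum]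
      refine Finset.sum_congr rfl fun p hp => ?_
      rw [map_smul, smul_smul, ← hb p hp]
    exact (smul_eq_zero.1 this).resolve_left hg
  obtain ⟨q, hqs, hq⟩ : ∃ q ∈ s, Odd (b q) := by
    by_contra! hall
    have h2 : (2 : ℤ) ∣ s.gcd b := Finset.dvd_gcd fun p hp =>
      (Int.not_odd_iff_even.1 (hall p hp)).two_dvd
    rw [hgcd] at h2
    norm_num at h2
  have hqχ : q.1.2 = p₀.1.2 := by simpa [hs] using hqs
  have hw : ∀ c g, (∑ p ∈ s, b p • v p).1 c g =
      (∑ p ∈ s, if c = p.1.1 then b p else 0) * ((q.1.2 g : ℤˣ) : ℤ) := by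
    intro c g
    have : (∑ p ∈ s, b p • v p).1 = ∑ p ∈ s, b p • (v p).1 := by
      simp
    rw [this, Finset.sum_apply, Finset.sum_apply, Finset.sum_mul]
    refine Finset.sum_congr rfl fun p hp => ?_
    have hpχ : p.1.2 = q.1.2 := by rw [hqχ]; simpa [hs] using hp
    by_cases hc : c = p.1.1 <;> simp [hv, hc, hpχ]
  -- At the element of the pair `q` this difference takes the values ±`b q` - 1, which are even. So
  -- the cocycle value agrees with a kernel element of ψ up to a norm.
  obtain ⟨y, hy⟩ := exists_add_cosetRep_eq hG
    (∑ p ∈ s, b p • v p - cosetCocycle hG hS q.1.1 q.1.1) q.2.1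
    (fun c g => by
      simp only [AddSubgroupClass.coe_sub, Pi.sub_apply, hw, map_mul, q.2.2]
      simp) (fun g => by
      simp only [AddSubgroupClass.coe_sub, Pi.sub_apply, hw]
      have h1 : (∑ p ∈ s, if q.1.1 = p.1.1 then b p else 0) = b q := by
        rw [Finset.sum_eq_single q]
        · simp
        · intro p hp hpq
          refine if_neg fun e => hpq ?_
          have hpχ : p.1.2 = q.1.2 := by rw [hqχ]; simpa [hs] using hp
          exact Subtype.ext (Prod.ext e.symm hpχ)
        · exact fun h => absurd hqs h
      rw [h1, cosetCocycle_apply, indicator_self hG q.2.1]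
      rcases Int.units_eq_one_or (q.1.2 g) with h | h <;> rw [h]
      · simpa using hq.sub_odd odd_one
      · simpa using hq.neg.sub_odd odd_one)
  refine hne q.1.1 q.2.1 (-y) ?_
  have h2 := congrArg ψ hy
  rw [map_sub, hsum', zero_sub] at h2
  rw [map_neg, ← neg_add, map_neg, h2, neg_neg]

end CosetLattice

/-! ### The lower bound for the Vasquez number -/

/-- For t ≠ 1 a third element c ∉ {1, t} exists since |G| ≥ 4. A character trivial on c but not on t
gives an eigenvector in the component at c that t negates. -/
theorem cosetRep_injective {G : Type} [Group G] [Fintype G] (hG : IsElementaryTwo G)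
    (h4 : 4 ≤ Fintype.card G) {S : Set G} (hS : ∀ c ≠ 1, c ∈ S) :
    Function.Injective (cosetRep hG S) := by
  classical
  refine (injective_iff_map_eq_one _).2 fun t ht => ?_
  by_contra ht1
  obtain ⟨c, hc⟩ : ∃ c, c ∉ ({1, t} : Finset G) :=
    Finset.exists_mem_notMem_of_card_lt_card (s := {1, t}) (t := Finset.univ)
      (lt_of_le_of_lt Finset.card_le_two (by rw [Finset.card_univ]; omega)) |>.imp fun _ h => h.2
  simp only [Finset.mem_insert, Finset.mem_singleton, not_or] at hc
  obtain ⟨χ, hχt, hχc⟩ := hG.exists_char_ne ht1 (Ne.symm hc.2)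
  have h1 := cosetRep_cosetEigenvector hG c χ (hS c hc.1) hχc t
  rw [ht] at h1
  have h2 := congrFun (congrFun (congrArg Subtype.val h1) c) 1
  simp [hχt] at h2

theorem IsVasquezBound.card_annPairNe_le {G : Type} [Group G] [Fintype G]
    (hG : IsElementaryTwo G) (h4 : 4 ≤ Fintype.card G) {N : ℕ} (hN : IsVasquezBound G N) :
    Nat.card (AnnPairNe G) ≤ N := by
  have hS : ∀ c : G, c ≠ 1 → c ∈ {c : G | c ≠ 1} := fun c hc => hc
  have hcoc : (fun p : G × G => cosetCocycle hG hS p.1 p.2) ∈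
      cocycles₂ (Rep.of (cosetRep hG {c : G | c ≠ 1})) := by
    rw [mem_cocycles₂_iff]
    intro a b d
    refine Subtype.ext (funext fun c => funext fun x => ?_)
    change indicator hG c (a * b) * indicator hG c d + indicator hG c a * indicator hG c b =
      indicator hG c b * indicator hG c d + indicator hG c a * indicator hG c (b * d)
    rw [indicator_mul, indicator_mul]
    ring
  let σ : cocycles₂ (Rep.of (cosetRep hG {c : G | c ≠ 1})) := ⟨_, hcoc⟩
  have hσ : ∀ c, σ (c, c) + σ (1, 1) = cosetCocycle hG hS c c := fun c => by
    refine Subtype.ext (funext fun d => funext fun x => ?_)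
    change indicator hG d c * indicator hG d c + indicator hG d 1 * indicator hG d 1 = _
    simp
  obtain ⟨W, hW, hpure, hrank, hspec⟩ := hN (cosetLattice {c : G | c ≠ 1}) (cosetRep hG _)
    (cosetRep_injective hG h4 hS) (H2π _ σ) (by
      rw [isSpecial_H2π_iff hG]
      intro c hc y hy
      rw [hσ] at hy
      -- At the identity of the component at c, a norm has the even value 2 y(1), while the cocycle
      -- has value 1.
      have := congrFun (congrFun (congrArg Subtype.val hy) c) 1
      change y.1 c 1 + y.1 c (1 * c) = _ at this
      rw [cosetCocycle_apply, indicator_self hG hc, y.2.1] at this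
      omega)
  rw [map_H2π, isSpecial_H2π_iff hG] at hspec
  have : Module.IsTorsionFree ℤ (cosetLattice {c : G | c ≠ 1} ⧸ W) := by
    refine Module.IsTorsionFree.of_smul_eq_zero fun m x hx => ?_
    obtain ⟨x, rfl⟩ := W.mkQ_surjective x
    by_contra! h
    refine h.2 ((Submodule.Quotient.mk_eq_zero W).2 (hpure m x h.1 ?_))
    exact (Submodule.Quotient.mk_eq_zero W).1 hx
  have hli := linearIndependent_map_cosetEigenvector hG hS ((cosetRep hG _).quotient W hW) W.mkQ
    (fun g x => rfl) (fun c hc y hy => by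
      refine hspec c hc (W.mkQ y) ?_
      rw [← hσ] at hy
      exact hy)
  have := Fintype.ofFinite (AnnPairNe G)
  rw [Nat.card_eq_fintype_card]
  exact hli.fintype_card_le_finrank.trans hrank

theorem IsElementaryTwo.vasquezNumber_eq {G : Type} [Group G] [Fintype G]
    (hG : IsElementaryTwo G) (h4 : 4 ≤ Fintype.card G) :
    vasquezNumber G = Nat.card (AnnPairNe G) :=
  le_antisymm (Nat.sInf_le hG.isVasquezBound)
    (le_csInf ⟨_, hG.isVasquezBound⟩ fun _ hN => hN.card_annPairNe_le hG h4)

/-! ### Hyperelliptic deck groups consist of affine maps -/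

/-- The Cauchy estimate on the circle of radius 1 + |c| about c bounds the derivative uniformly in
c, so the derivative is constant by Liouville. -/
theorem eq_add_smul_deriv_of_linear_growth {E : Type} [NormedAddCommGroup E]
    [NormedSpace ℂ E] [CompleteSpace E] {f : ℂ → E} (hf : Differentiable ℂ f) {a C : ℝ} (ha : 0 ≤ a)
    (hC : 0 ≤ C) (h : ∀ t, ‖f t‖ ≤ a * ‖t‖ + C) (t : ℂ) : f t = f 0 + t • deriv f 0 := by
  have hb : ∀ c, ‖deriv f c‖ ≤ 2 * a + C := by
    intro c
    have hR : 0 < 1 + ‖c‖ := by positivity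
    refine (Complex.norm_deriv_le_of_forall_mem_sphere_norm_le hR hf.diffContOnCl
      (C := a * (2 * ‖c‖ + 1) + C) fun z hz => (h z).trans ?_).trans ?_
    · have : ‖z‖ ≤ 2 * ‖c‖ + 1 := by
        have h1 : ‖z - c‖ = 1 + ‖c‖ := by simpa [dist_eq_norm] using hz
        have h2 := norm_sub_norm_le z c
        linarith
      gcongr
    · rw [div_le_iff₀ hR]
      nlinarith [norm_nonneg c, mul_nonneg ha (norm_nonneg c), mul_nonneg hC (norm_nonneg c)]
  have hconst : ∀ c, deriv f c = deriv f 0 := fun c =>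
    Differentiable.apply_eq_apply_of_bounded hf.deriv
      (isBounded_iff_forall_norm_le.2 ⟨2 * a + C, by rintro _ ⟨c, rfl⟩; exact hb c⟩) c 0
  have hd : ∀ c, HasDerivAt (fun t => f t - t • deriv f 0) 0 c := by
    intro c
    have := (hf c).hasDerivAt.fun_sub ((hasDerivAt_id c).smul_const (deriv f 0))
    simpa [hconst c] using this
  have := is_const_of_deriv_eq_zero (fun c => (hd c).differentiableAt) (fun c => (hd c).deriv) t 0
  simp only [zero_smul, sub_zero] at this
  rw [← this]
  abel

/-- The increments of f along Λ are additive and extend to a real-linear map `B`. Then f - B is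
periodic, hence bounded, so f grows at most linearly and is affine on every complex line through 0.
-/
theorem eq_fderiv_add_of_quasiperiodic {n : ℕ} {f : (Fin n → ℂ) → (Fin n → ℂ)}
    (hf : Differentiable ℂ f) (Λ : Submodule ℤ (Fin n → ℂ)) [DiscreteTopology Λ]
    [IsZLattice ℝ Λ] (h : ∀ v ∈ Λ, ∃ u, ∀ z, f (z + v) = f z + u) (z : Fin n → ℂ) :
    f z = fderiv ℂ f 0 z + f 0 := by
  have : Module.Free ℤ Λ := ZLattice.module_free ℝ Λ
  have : Module.Finite ℤ Λ := ZLattice.module_finite ℝ Λ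
  have hu : ∀ v ∈ Λ, ∀ z, f (z + v) = f z + (f v - f 0) := by
    intro v hv z
    obtain ⟨u, hu⟩ := h v hv
    have h0 := hu 0
    rw [zero_add] at h0
    rw [hu z, h0]
    abel
  let b := Module.Free.chooseBasis ℤ Λ
  let B : (Fin n → ℂ) →ₗ[ℝ] (Fin n → ℂ) := (b.ofZLatticeBasis ℝ Λ).constr ℝ fun i => f (b i) - f 0
  let φ : Λ →+ (Fin n → ℂ) :=
    { toFun := fun v => f v - f 0
      map_zero' := by simp
      map_add' := fun v w => by
        rw [Submodule.coe_add, hu w w.2]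
        abel }
  have hφ : φ.toIntLinearMap = (B.restrictScalars ℤ) ∘ₗ Λ.subtype := by
    refine b.ext fun i => ?_
    have : (b i : Fin n → ℂ) = b.ofZLatticeBasis ℝ Λ i := (b.ofZLatticeBasis_apply ℝ Λ i).symm
    change f (b i) - f 0 = B (b i)
    nth_rw 2 [this]
    rw [Module.Basis.constr_basis]
  have hB : ∀ v ∈ Λ, B v = f v - f 0 := fun v hv => (LinearMap.congr_fun hφ ⟨v, hv⟩).symm
  have hcont : Continuous fun z => f z - B z :=
    hf.continuous.sub B.continuous_of_finiteDimensional
  have hcomp := IsZLattice.isCompact_range_of_periodic Λ (fun z => f z - B z) hcont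
    (fun z v hv => by
      change f (z + v) - B (z + v) = f z - B z
      rw [hu v hv, map_add, hB v hv]
      abel)
  obtain ⟨C, hC⟩ := isBounded_iff_forall_norm_le.1 hcomp.isBounded
  have hC0 : 0 ≤ C := (norm_nonneg _).trans (hC _ ⟨0, rfl⟩)
  let B' := B.toContinuousLinearMap
  have hgrow : ∀ z, ‖f z‖ ≤ ‖B'‖ * ‖z‖ + C := by
    intro z
    have h1 : f z = B' z + (f z - B z) := by
      change f z = B z + (f z - B z)
      abel
    rw [h1]
    exact (norm_add_le _ _).trans (add_le_add (B'.le_opNorm z) (hC _ ⟨z, rfl⟩))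
  have hline : Differentiable ℂ fun t : ℂ => f (t • z) :=
    hf.comp (differentiable_id.smul_const z)
  have := eq_add_smul_deriv_of_linear_growth hline (a := ‖B'‖ * ‖z‖) (by positivity) hC0
    (fun t => (hgrow _).trans (le_of_eq (by rw [norm_smul]; ring))) 1
  have hder : HasDerivAt (fun t : ℂ => f (t • z)) (fderiv ℂ f 0 z) 0 := by
    have h1 : HasDerivAt (fun t : ℂ => t • z) z 0 := by
      simpa using (hasDerivAt_id (0 : ℂ)).smul_const z
    have h2 : HasFDerivAt f (fderiv ℂ f 0) ((0 : ℂ) • z) := by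
      rw [zero_smul]; exact (hf 0).hasFDerivAt
    exact h2.comp_hasDerivAt 0 h1
  rw [hder.deriv] at this
  simp only [one_smul, zero_smul] at this
  rw [this, add_comm]

theorem addRight_mem_translationGroup {n : ℕ} {Λ : Submodule ℤ (Fin n → ℂ)} {v : Fin n → ℂ}
    (hv : v ∈ Λ) : Equiv.addRight v ∈ translationGroup Λ := ⟨v, hv, fun _ => rfl⟩

theorem IsHyperellipticDeckGroup.apply_eq {n : ℕ} {Λ : Submodule ℤ (Fin n → ℂ)}
    {Δ : Subgroup (Equiv.Perm (Fin n → ℂ))} (h : IsHyperellipticDeckGroup Λ Δ)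
    {γ : Equiv.Perm (Fin n → ℂ)} (hγ : γ ∈ Δ) (z : Fin n → ℂ) :
    γ z = fderiv ℂ γ 0 z + γ 0 := by
  have := h.discrete
  have : IsZLattice ℝ Λ := ⟨h.span_eq_top⟩
  refine eq_fderiv_add_of_quasiperiodic (h.holomorphic γ hγ) Λ (fun v hv => ?_) z
  have h1 := h.normal.conj_mem ⟨Equiv.addRight v, h.translations_le (addRight_mem_translationGroup hv)⟩
    (addRight_mem_translationGroup hv) ⟨γ, hγ⟩
  obtain ⟨u, -, hu⟩ := h1
  refine ⟨u, fun z => ?_⟩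
  have := hu (γ z)
  simpa using this

/-- The affine structure of a hyperelliptic deck group which is an extension of a finite group `G`
by an abelian group. -/
theorem IsHyperellipticDeckGroup.exists_linearPart {Γ G : Type} [Group Γ] [Group G] [Finite G]
    (π : Γ →* G) (hπ : Function.Surjective π)
    (hab : ∀ x y, π x = 1 → π y = 1 → x * y = y * x) {n : ℕ}
    (Ψ : Γ →* Equiv.Perm (Fin n → ℂ)) {Λ : Submodule ℤ (Fin n → ℂ)}
    (h : IsHyperellipticDeckGroup Λ Ψ.range) :
    (∀ γ, Ψ γ * Ψ γ = 1 → Ψ γ = 1) ∧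
    ∃ A : Representation ℂ G (Fin n → ℂ), (∀ γ z, Ψ γ z = A (π γ) z + Ψ γ 0) ∧
      ∃ Λ' : Submodule ℤ (Fin n → ℂ), (∀ v, v ∈ Λ' ↔ ∃ γ, π γ = 1 ∧ Ψ γ 0 = v) ∧
        DiscreteTopology Λ' ∧ Submodule.span ℝ (Λ' : Set (Fin n → ℂ)) = ⊤ := by
  have hdisc := h.discrete
  let A₀ : Γ → (Fin n → ℂ) →ₗ[ℂ] (Fin n → ℂ) := fun γ => (fderiv ℂ (Ψ γ) 0 : _ →L[ℂ] _)
  have hA₀ : ∀ γ z, Ψ γ z = A₀ γ z + Ψ γ 0 := fun γ z => h.apply_eq ⟨γ, rfl⟩ z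
  have hA₀' : ∀ γ z, A₀ γ z = Ψ γ z - Ψ γ 0 := fun γ z => by rw [hA₀ γ z, add_sub_cancel_right]
  have hmul : ∀ γ δ, A₀ (γ * δ) = A₀ γ * A₀ δ := by
    intro γ δ
    refine LinearMap.ext fun z => ?_
    rw [Module.End.mul_apply, hA₀' (γ * δ), hA₀' δ, map_sub, hA₀' γ, hA₀' γ, map_mul]
    simp
  have htrans : ∀ v ∈ Λ, ∃ δ, ∀ z, Ψ δ z = z + v := fun v hv => by
    obtain ⟨δ, hδ⟩ := h.translations_le (addRight_mem_translationGroup hv)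
    exact ⟨δ, fun z => by rw [hδ]; rfl⟩
  have hpow : ∀ (δ : Γ) (v : Fin n → ℂ), (∀ z, Ψ δ z = z + v) → ∀ (m : ℕ) z,
      Ψ (δ ^ m) z = z + m • v := by
    intro δ v hδ m
    induction m with
    | zero => simp
    | succ m ih => intro z; rw [pow_succ, map_mul, Equiv.Perm.mul_apply, hδ, ih]; module
  have hcard : Nat.card G ≠ 0 := Nat.card_pos.ne'
  -- Translations in Λ need not lie in the kernel of `π`, but their |G|-th powers do; |G|Λ still
  -- spans.
  have hker : ∀ v ∈ Λ, ∃ δ, π δ = 1 ∧ ∀ z, Ψ δ z = z + Nat.card G • v := by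
    intro v hv
    obtain ⟨δ, hδ⟩ := htrans v hv
    exact ⟨δ ^ Nat.card G, by rw [map_pow, pow_card_eq_one'], hpow δ v hδ _⟩
  have hone : ∀ γ, π γ = 1 → A₀ γ = 1 := by
    intro γ hγ
    have hspan : (A₀ γ).restrictScalars ℝ = LinearMap.id := by
      refine LinearMap.ext_on h.span_eq_top fun v hv => ?_
      -- Commuting with the translation by |G|v forces the linear part to fix v.
      obtain ⟨δ, hδ1, hδ⟩ := hker v hv
      have h1 := congrArg (fun x => Ψ x 0) (hab γ δ hγ hδ1)
      simp only [map_mul, Equiv.Perm.mul_apply, hδ, zero_add] at h1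
      rw [hA₀ γ, add_comm, add_left_cancel_iff, map_nsmul] at h1
      exact smul_right_injective _ hcard h1
    exact LinearMap.ext fun z => LinearMap.congr_fun hspan z
  have hfac : ∀ γ δ, π γ = π δ → A₀ γ = A₀ δ := by
    intro γ δ e
    have h1 : γ = (γ * δ⁻¹) * δ := by simp
    rw [h1, hmul, hone _ (by rw [map_mul, map_inv, e, mul_inv_cancel]), one_mul]
  let A : Representation ℂ G (Fin n → ℂ) :=
    { toFun := fun g => A₀ (Function.surjInv hπ g)
      map_one' := hone _ (Function.surjInv_eq hπ 1)
      map_mul' := fun a b => by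
        rw [← hmul]
        exact hfac _ _ (by simp [Function.surjInv_eq]) }
  have hA : ∀ γ z, Ψ γ z = A (π γ) z + Ψ γ 0 := fun γ z => by
    rw [hA₀ γ z]
    exact congrArg (fun F : (Fin n → ℂ) →ₗ[ℂ] (Fin n → ℂ) => F z + Ψ γ 0)
      (hfac _ _ (Function.surjInv_eq hπ (π γ)).symm)
  have htr : ∀ γ, π γ = 1 → ∀ z, Ψ γ z = z + Ψ γ 0 := fun γ hγ z => by
    rw [hA γ z, hγ, map_one]; rfl
  refine ⟨fun γ hγ => ?_, A, hA, ?_⟩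
  -- An affine involution fixes the midpoint of 0 and its image, so a free action admits no element
  -- of order two.
  · refine h.free _ ⟨γ, rfl⟩ ((1 / 2 : ℂ) • Ψ γ 0) ?_
    have h1 : Ψ γ (Ψ γ 0) = 0 := by
      rw [← Equiv.Perm.mul_apply, hγ]; rfl
    rw [hA γ] at h1
    rw [hA γ, map_smul, eq_neg_of_add_eq_zero_left h1]
    module
  · let L : AddSubgroup (Fin n → ℂ) :=
      { carrier := {v | ∃ γ, π γ = 1 ∧ Ψ γ 0 = v}
        zero_mem' := ⟨1, by simp⟩
        add_mem' := by
          rintro _ _ ⟨γ, hγ, rfl⟩ ⟨δ, hδ, rfl⟩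
          refine ⟨δ * γ, by simp [hγ, hδ], ?_⟩
          rw [map_mul, Equiv.Perm.mul_apply, htr δ hδ]
        neg_mem' := by
          rintro _ ⟨γ, hγ, rfl⟩
          refine ⟨γ⁻¹, by simp [hγ], ?_⟩
          rw [map_inv, Equiv.Perm.inv_eq_iff_eq, htr γ hγ, neg_add_cancel] }
    refine ⟨AddSubgroup.toIntSubmodule L, fun v => Iff.rfl, ?_, ?_⟩
    · have := h.normal
      have := h.finite
      set N := ((translationGroup Λ).subgroupOf Ψ.range).index with hN
      have hN0 : N ≠ 0 := Subgroup.FiniteIndex.index_ne_zero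
      -- Multiplication by the index embeds the new lattice continuously into the discrete Λ.
      have hmem : ∀ v ∈ L, N • v ∈ Λ := by
        rintro _ ⟨γ, hγ, rfl⟩
        have h1 := Subgroup.pow_index_mem ((translationGroup Λ).subgroupOf Ψ.range)
          ⟨Ψ γ, ⟨γ, rfl⟩⟩
        obtain ⟨u, hu, hu'⟩ := h1
        have h2 := hu' 0
        rw [← hN] at h2
        have h3 := hpow γ _ (htr γ hγ) N 0
        rw [map_pow] at h3
        rw [zero_add] at h2 h3
        rw [← h3]
        exact h2 ▸ hu
      let F : AddSubgroup.toIntSubmodule L → Λ := fun v => ⟨N • v.1, hmem _ v.2⟩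
      refine DiscreteTopology.of_continuous_injective (f := F) ?_ ?_
      · exact Continuous.subtype_mk (continuous_subtype_val.const_smul N) _
      · intro v w hvw
        exact Subtype.ext (smul_right_injective _ hN0 (congrArg Subtype.val hvw))
    · rw [eq_top_iff, ← h.span_eq_top, Submodule.span_le]
      intro v hv
      obtain ⟨δ, hδ1, hδ⟩ := hker v hv
      have h1 : Nat.card G • v ∈ Submodule.span ℝ (AddSubgroup.toIntSubmodule L : Set _) :=
        Submodule.subset_span ⟨δ, hδ1, by rw [hδ, zero_add]⟩
      have h2 := Submodule.smul_mem _ ((Nat.card G : ℝ)⁻¹) h1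
      rwa [← Nat.cast_smul_eq_nsmul ℝ, smul_smul, inv_mul_cancel₀ (by exact_mod_cast hcard),
        one_smul] at h2

/-! ### Realising crossed homomorphisms by hyperelliptic deck groups -/

/-- Real coordinates are paired within a single character, so that sign actions become complex
linear once each pair is read as a complex number. -/
theorem exists_equiv_prod_fin_two {J X : Type} [Fintype J] [Finite X] (cls : J → X)
    (heven : ∀ x, Even (Nat.card {j // cls j = x})) {n : ℕ} (hn : 2 * n = Fintype.card J) :
    ∃ e : J ≃ Fin n × Fin 2, ∀ i, cls (e.symm (i, 1)) = cls (e.symm (i, 0)) := by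
  have := Fintype.ofFinite X
  choose m hm using heven
  have e₁ : ∀ x, Nonempty ({j // cls j = x} ≃ Fin (m x) × Fin 2) := fun x => by
    refine ⟨(Finite.equivFinOfCardEq (hm x)).trans (Fintype.equivOfCardEq ?_)⟩
    simp [mul_two]
  let e₂ : J ≃ (Σ x, Fin (m x)) × Fin 2 :=
    ((Equiv.sigmaFiberEquiv cls).symm.trans (Equiv.sigmaCongrRight fun x => (e₁ x).some)).trans
      (Equiv.sigmaProdDistrib _ _).symm
  have hcls : ∀ y b, cls (e₂.symm (y, b)) = y.1 := fun y b =>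
    ((e₁ y.1).some.symm (y.2, b)).2
  have hcard : Fintype.card (Σ x, Fin (m x)) = n := by
    have := Fintype.card_congr e₂
    rw [Fintype.card_prod, Fintype.card_fin] at this
    omega
  refine ⟨e₂.trans ((Fintype.equivFinOfCardEq hcard).prodCongr (Equiv.refl _)), fun i => ?_⟩
  exact (hcls _ _).trans (hcls _ _).symm

/-- The identification of `ℝ^J` with `ℂ^n` given by a pairing of the coordinates. -/
noncomputable def complexCoordinates {J : Type} {n : ℕ} (e : J ≃ Fin n × Fin 2) :
    (J → ℝ) ≃ₗ[ℝ] (Fin n → ℂ) where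
  toFun f i := ⟨f (e.symm (i, 0)), f (e.symm (i, 1))⟩
  map_add' f f' := by
    funext i
    apply Complex.ext <;> simp
  map_smul' r f := by
    funext i
    apply Complex.ext <;> simp
  invFun z j := if (e j).2 = 0 then (z (e j).1).re else (z (e j).1).im
  left_inv f := by
    funext j
    obtain ⟨⟨i, b⟩, rfl⟩ := e.symm.surjective j
    fin_cases b <;> simp
  right_inv z := by
    funext i
    simp

/-- γ acts by z ↦ ε(π γ) z + t(γ) in the paired coordinates. A fixed point of γ with π γ ≠ 1 is also
fixed by γ², which is translation by t(γ²) ≠ 0. The action may have a kernel: that kernel is the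
subgroup to be divided out. -/
theorem exists_hyperelliptic_of_crossedHom {Γ G : Type} [Group Γ] [Group G] [Finite G]
    (hG : IsElementaryTwo G) (π : Γ →* G) {J : Type} [Fintype J] (cls : J → G →* ℤˣ)
    (heven : ∀ χ, Even (Nat.card {j // cls j = χ})) (t : Γ → J → ℝ)
    (ht : ∀ γ δ j, t (γ * δ) j = t γ j + ((cls j (π γ) : ℤˣ) : ℤ) * t δ j)
    (hint : ∀ γ, π γ = 1 → ∀ j, ∃ m : ℤ, t γ j = m)
    (hspan : Submodule.span ℝ (t '' {γ | π γ = 1}) = ⊤)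
    (hfree : ∀ γ, π γ ≠ 1 → t (γ * γ) ≠ 0) {n : ℕ} (hn : 2 * n = Fintype.card J) :
    ∃ (Λ : Submodule ℤ (Fin n → ℂ)) (Ψ : Γ →* Equiv.Perm (Fin n → ℂ)),
      IsHyperellipticDeckGroup Λ Ψ.range ∧ ∀ γ, Ψ γ = 1 → π γ = 1 ∧ t γ = 0 := by
  obtain ⟨e, he⟩ := exists_equiv_prod_fin_two cls heven hn
  let Φ := complexCoordinates e
  let ε : G → Fin n → ℂ := fun g i => (((cls (e.symm (i, 0)) g : ℤˣ) : ℤ) : ℂ)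
  have hΦε : ∀ γ δ, Φ (t (γ * δ)) = Φ (t γ) + ε (π γ) * Φ (t δ) := by
    intro γ δ
    funext i
    apply Complex.ext
    · simp [Φ, complexCoordinates, ε, ht]
    · simp [Φ, complexCoordinates, ε, ht, he]
  have ht1 : t 1 = 0 := by
    funext j
    have := ht 1 1 j
    simpa using this
  have htmul : ∀ γ δ, π γ = 1 → t (γ * δ) = t γ + t δ := fun γ δ hγ => by
    funext j
    simp [ht, hγ]
  let Ψ' : Γ →* Function.End (Fin n → ℂ) :=
    { toFun := fun γ z => ε (π γ) * z + Φ (t γ)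
      map_one' := by
        funext z
        simp only [ht1, map_zero, add_zero, map_one]
        ext i
        simp [ε, Function.End.one_def]
      map_mul' := fun γ δ => by
        funext z
        change ε (π (γ * δ)) * z + Φ (t (γ * δ)) = ε (π γ) * (ε (π δ) * z + Φ (t δ)) + Φ (t γ)
        rw [hΦε, map_mul]
        have : ε (π γ * π δ) = ε (π γ) * ε (π δ) := by
          funext i
          simp [ε]
        rw [this]
        ring }
  let Ψ : Γ →* Equiv.Perm (Fin n → ℂ) := Ψ'.toHomPerm
  have hΨ : ∀ γ z, Ψ γ z = ε (π γ) * z + Φ (t γ) := fun γ z => rfl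
  have hε1 : ε 1 = 1 := by
    funext i
    simp [ε]
  have hΨ1 : ∀ γ, π γ = 1 → ∀ z, Ψ γ z = z + Φ (t γ) := fun γ hγ z => by
    rw [hΨ, hγ, hε1, one_mul]
  have hfix : ∀ γ z, Ψ γ z = z → π γ = 1 ∧ t γ = 0 := by
    intro γ z hz
    by_cases hγ : π γ = 1
    · refine ⟨hγ, ?_⟩
      rw [hΨ1 γ hγ] at hz
      simpa using hz
    · exfalso
      have h1 : π (γ * γ) = 1 := by rw [map_mul, hG.mul_self]
      have h2 : Ψ (γ * γ) z = z := by rw [map_mul, Equiv.Perm.mul_apply, hz, hz]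
      rw [hΨ1 _ h1] at h2
      exact hfree γ hγ (by simpa using h2)
  let L : AddSubgroup (Fin n → ℂ) :=
    { carrier := {v | ∃ γ, π γ = 1 ∧ Φ (t γ) = v}
      zero_mem' := ⟨1, by simp [ht1]⟩
      add_mem' := by
        rintro _ _ ⟨γ, hγ, rfl⟩ ⟨δ, hδ, rfl⟩
        exact ⟨γ * δ, by simp [hγ, hδ], by rw [htmul γ δ hγ, map_add]⟩
      neg_mem' := by
        rintro _ ⟨γ, hγ, rfl⟩
        refine ⟨γ⁻¹, by simp [hγ], ?_⟩
        have := htmul γ γ⁻¹ hγ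
        rw [mul_inv_cancel, ht1] at this
        rw [← map_neg, eq_neg_of_add_eq_zero_right this.symm] }
  have hL : ∀ v, v ∈ AddSubgroup.toIntSubmodule L ↔ ∃ γ, π γ = 1 ∧ Φ (t γ) = v := fun v => Iff.rfl
  have hT : ∀ γ, π γ = 1 → Ψ γ ∈ translationGroup (AddSubgroup.toIntSubmodule L) := fun γ hγ =>
    ⟨Φ (t γ), ⟨γ, hγ, rfl⟩, hΨ1 γ hγ⟩
  have hT' : ∀ p ∈ translationGroup (AddSubgroup.toIntSubmodule L), ∃ γ, π γ = 1 ∧ Ψ γ = p := by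
    rintro p ⟨_, ⟨γ, hγ, rfl⟩, hp⟩
    exact ⟨γ, hγ, Equiv.ext fun z => by rw [hp, hΨ1 γ hγ]⟩
  refine ⟨AddSubgroup.toIntSubmodule L, Ψ, ?_, fun γ hγ => hfix γ 0 (by rw [hγ]; rfl)⟩
  constructor
  · have hmem : ∀ v ∈ AddSubgroup.toIntSubmodule L,
        Φ.symm v ∈ Submodule.span ℤ (Set.range (Pi.basisFun ℝ J)) := by
      rintro _ ⟨γ, hγ, rfl⟩
      rw [Module.Basis.mem_span_iff_repr_mem]
      intro j
      obtain ⟨m, hm⟩ := hint γ hγ j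
      exact ⟨m, by simp [hm]⟩
    let F : AddSubgroup.toIntSubmodule L → Submodule.span ℤ (Set.range (Pi.basisFun ℝ J)) :=
      fun v => ⟨Φ.symm v, hmem v v.2⟩
    refine DiscreteTopology.of_continuous_injective (f := F) ?_ ?_
    · refine Continuous.subtype_mk ?_ _
      exact (LinearMap.continuous_of_finiteDimensional Φ.symm.toLinearMap).comp
        continuous_subtype_val
    · intro v w hvw
      exact Subtype.ext (Φ.symm.injective (congrArg Subtype.val hvw))
  · have : (AddSubgroup.toIntSubmodule L : Set (Fin n → ℂ)) = Φ '' (t '' {γ | π γ = 1}) := by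
      rw [Set.image_image]
      exact Set.ext hL
    have h2 := Submodule.span_image (s := t '' {γ | π γ = 1}) Φ.toLinearMap
    rw [hspan, Submodule.map_top, LinearEquiv.range] at h2
    rw [this]
    exact h2
  · intro p hp
    obtain ⟨γ, -, rfl⟩ := hT' p hp
    exact ⟨γ, rfl⟩
  · constructor
    rintro ⟨_, _⟩ hp ⟨_, δ, rfl⟩
    obtain ⟨γ, hγ, rfl⟩ := hT' _ hp
    have := hT (δ * γ * δ⁻¹) (by simp [hγ])
    simpa [Subgroup.mem_subgroupOf] using this
  · constructor
    have h1 : π.ker ≤ (translationGroup (AddSubgroup.toIntSubmodule L)).comap Ψ :=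
      fun γ hγ => hT γ hγ
    have := Subgroup.finiteIndex_of_le h1
    have h2 := this.index_ne_zero
    rwa [Subgroup.index_comap] at h2
  · rintro _ ⟨γ, rfl⟩
    have : Differentiable ℂ fun z : Fin n → ℂ => ε (π γ) * z + Φ (t γ) := by fun_prop
    exact this
  · rintro _ ⟨γ, rfl⟩ z hz
    obtain ⟨h1, h2⟩ := hfix γ z hz
    exact Equiv.ext fun w => by rw [hΨ1 γ h1, h2, map_zero, add_zero]; rfl

/-! ### Linear algebra over the reals -/

/-- (det J)² = (-1)^dim cannot be negative. -/
theorem even_finrank_of_mul_self_eq_neg_one {W : Type} [AddCommGroup W] [Module ℝ W]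
    (J : W →ₗ[ℝ] W) (hJ : ∀ x, J (J x) = -x) : Even (Module.finrank ℝ W) := by
  by_contra h
  rw [Nat.not_even_iff_odd] at h
  have h1 : J ∘ₗ J = (-1 : ℝ) • LinearMap.id := by
    ext x
    simp [hJ]
  have h2 := congrArg LinearMap.det h1
  rw [LinearMap.det_comp, LinearMap.det_smul, LinearMap.det_id, h.neg_one_pow] at h2
  nlinarith [mul_self_nonneg (LinearMap.det J)]

/-- An independent set of odd size cannot span an even-dimensional space, so there is room for one
more vector of S. This rounding to an even size is the source of the extra term in the complex
bound. -/
theorem exists_even_linearIndependent {W ι : Type} [AddCommGroup W] [Module ℝ W]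
    [FiniteDimensional ℝ W] (hW : Even (Module.finrank ℝ W)) [Fintype ι] (f : ι → W) {S : Set W}
    (hS : Submodule.span ℝ S = ⊤) (hf : ∀ i, f i ∈ S) :
    ∃ b : Set W, b ⊆ S ∧ LinearIndependent ℝ ((↑) : b → W) ∧ Even b.ncard ∧
      b.ncard ≤ Fintype.card ι + 1 ∧ ∀ i, f i ∈ Submodule.span ℝ b := by
  obtain ⟨b, hb, hspan, hli⟩ := exists_linearIndependent ℝ (Set.range f)
  have hbf : b.Finite := hli.setFinite
  have hcard : b.ncard ≤ Fintype.card ι := by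
    rw [← Nat.card_eq_fintype_card, ← Set.ncard_univ]
    refine (Set.ncard_le_ncard hb (Set.finite_range f)).trans ?_
    rw [← Set.image_univ]
    exact Set.ncard_image_le
  have hbS : b ⊆ S := hb.trans (Set.range_subset_iff.2 hf)
  have hfb : ∀ i, f i ∈ Submodule.span ℝ b := fun i => by
    rw [hspan]
    exact Submodule.subset_span ⟨i, rfl⟩
  by_cases hbe : Even b.ncard
  · exact ⟨b, hbS, hli, hbe, hcard.trans (Nat.le_succ _), hfb⟩
  · obtain ⟨b', hb'S, hbb', hsp, hli'⟩ := exists_linearIndepOn_id_extension hli hbS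
    have hb'f : b'.Finite := LinearIndependent.setFinite hli'
    have hne : b ≠ b' := by
      rintro rfl
      apply hbe
      have htop : Submodule.span ℝ b = ⊤ := by
        rw [eq_top_iff, ← hS, Submodule.span_le]
        exact hsp
      have := hbf.fintype
      rw [Set.ncard_eq_toFinset_card' b, ← finrank_span_set_eq_card hli, htop,
        finrank_top]
      exact hW
    obtain ⟨x, hx, hxb⟩ := Set.exists_of_ssubset (hbb'.ssubset_of_ne hne)
    have hins : insert x b ⊆ b' := Set.insert_subset hx hbb'
    refine ⟨insert x b, hins.trans hb'S, LinearIndepOn.mono hli' hins, ?_, ?_, fun i => ?_⟩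
    · rw [Set.ncard_insert_of_notMem hxb hbf]
      exact (Nat.not_even_iff_odd.1 hbe).add_one
    · rw [Set.ncard_insert_of_notMem hxb hbf]
      omega
    · exact Submodule.span_mono (Set.subset_insert x b) (hfb i)

/-- A nonzero functional vanishing on the range would be a linear relation among the φ_j. -/
theorem pi_surjective_of_linearIndependent {V J : Type} [AddCommGroup V] [Module ℝ V] [Fintype J]
    (φ : J → V →ₗ[ℝ] ℝ) (hφ : LinearIndependent ℝ φ) :
    LinearMap.range (LinearMap.pi φ) = ⊤ := by
  classical
  by_contra h
  obtain ⟨g, hg, hle⟩ := Submodule.exists_le_ker_of_lt_top _ (lt_top_iff_ne_top.2 h)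
  apply hg
  have hsum : ∀ x : J → ℝ, g x = ∑ j, x j * g (Pi.single j 1) := fun x => by
    conv_lhs => rw [pi_eq_sum_univ' x, map_sum]
    exact Finset.sum_congr rfl fun j _ => by rw [map_smul, smul_eq_mul]
  have h0 : ∀ j, g (Pi.single j 1) = 0 := by
    refine Fintype.linearIndependent_iff.1 hφ (fun j => g (Pi.single j 1)) (LinearMap.ext fun v => ?_)
    have h1 : g (LinearMap.pi φ v) = 0 := hle ⟨v, rfl⟩
    rw [hsum] at h1
    simpa [mul_comm] using h1
  exact LinearMap.ext fun x => by simp [hsum x, h0]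

/-- Eigenvectors for distinct sign characters are independent. -/
theorem eq_zero_of_sum_eigenvector_eq_zero {G M : Type} [Group G] [Fintype G]
    [Fintype (G →* ℤˣ)] [AddCommGroup M] [IsAddTorsionFree M] (T : G → M →+ M)
    (x : (G →* ℤˣ) → M) (hx : ∀ χ g, T g (x χ) = ((χ g : ℤˣ) : ℤ) • x χ)
    (h : ∑ χ, x χ = 0) (ψ : G →* ℤˣ) : x ψ = 0 := by
  classical
  have h1 : ∑ g : G, ((ψ g : ℤˣ) : ℤ) • T g (∑ χ, x χ) = 0 := by simp [h]
  simp only [map_sum, hx, Finset.smul_sum, smul_smul] at h1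
  rw [Finset.sum_comm] at h1
  simp only [← Finset.sum_smul, sum_group_char_mul] at h1
  simp only [ite_smul, zero_smul, Finset.sum_ite_eq, Finset.mem_univ, if_true] at h1
  exact (smul_eq_zero_iff_right (by exact_mod_cast Fintype.card_ne_zero)).1 h1

/-! ### Isotypic functionals on a complex representation -/

section Isotypic

variable {G : Type} [Group G] {n : ℕ} (A : Representation ℂ G (Fin n → ℂ))

/-- The real representation underlying a complex representation. -/
noncomputable def realification : Representation ℝ G (Fin n → ℂ) where
  toFun g := (A g).restrictScalars ℝ
  map_one' := by rw [map_one]; rfl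
  map_mul' a b := by rw [map_mul]; rfl

@[simp]
theorem realification_apply (g : G) (z : Fin n → ℂ) : realification A g z = A g z := rfl

/-- The real functionals that transform by the sign character `χ`. -/
def isotypicDual (χ : G →* ℤˣ) : Submodule ℝ ((Fin n → ℂ) →ₗ[ℝ] ℝ) where
  carrier := {φ | ∀ g z, φ (realification A g z) = ((χ g : ℤˣ) : ℤ) • φ z}
  zero_mem' := fun g z => by simp
  add_mem' := fun {φ ψ} hφ hψ g z => by
    rw [LinearMap.add_apply, LinearMap.add_apply, hφ, hψ, smul_add]
  smul_mem' := fun r φ hφ g z => by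
    rw [LinearMap.smul_apply, LinearMap.smul_apply, hφ, smul_comm]

theorem even_finrank_isotypicDual (χ : G →* ℤˣ) :
    Even (Module.finrank ℝ (isotypicDual A χ)) := by
  let I : (Fin n → ℂ) →ₗ[ℝ] (Fin n → ℂ) :=
    ((Complex.I • LinearMap.id : (Fin n → ℂ) →ₗ[ℂ] (Fin n → ℂ))).restrictScalars ℝ
  let J : ((Fin n → ℂ) →ₗ[ℝ] ℝ) →ₗ[ℝ] ((Fin n → ℂ) →ₗ[ℝ] ℝ) := LinearMap.lcomp ℝ ℝ I
  have hJ : ∀ φ z, J φ z = φ (Complex.I • z) := fun φ z => rfl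
  refine even_finrank_of_mul_self_eq_neg_one (W := isotypicDual A χ)
    (J.restrict (p := isotypicDual A χ) (q := isotypicDual A χ) fun φ hφ g z => ?_) fun φ => ?_
  · rw [hJ, hJ, realification_apply, ← map_smul, ← realification_apply, hφ]
  · refine Subtype.ext (LinearMap.ext fun z => ?_)
    change φ.1 (Complex.I • Complex.I • z) = -(φ.1 z)
    rw [smul_smul, Complex.I_mul_I, neg_one_smul, map_neg]

variable [Fintype G]

theorem twistedSum_mem_isotypicDual (χ : G →* ℤˣ) (φ : (Fin n → ℂ) →ₗ[ℝ] ℝ) :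
    twistedSum (realification A) χ φ ∈ isotypicDual A χ :=
  fun g z => twistedSum_apply_rho (realification A) χ φ g z

variable {A} {Λ : Submodule ℤ (Fin n → ℂ)}

theorem twistedSum_integral (hΛ : ∀ g, ∀ v ∈ Λ, A g v ∈ Λ) (χ : G →* ℤˣ)
    {φ : (Fin n → ℂ) →ₗ[ℝ] ℝ} (hφ : ∀ v ∈ Λ, ∃ m : ℤ, φ v = m) :
    ∀ v ∈ Λ, ∃ m : ℤ, twistedSum (realification A) χ φ v = m := by
  intro v hv
  choose m hm using fun g => hφ _ (hΛ g v hv)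
  refine ⟨∑ g : G, ((χ g : ℤˣ) : ℤ) * m g, ?_⟩
  rw [twistedSum_apply]
  push_cast
  exact Finset.sum_congr rfl fun g _ => by rw [realification_apply, hm, zsmul_eq_mul]

/-- The coordinates of a ℤ-basis of Λ are integral and span the dual; their χ-projections stay
integral and span the χ-component. -/
theorem span_integral_isotypicDual [DiscreteTopology Λ] [IsZLattice ℝ Λ]
    (hΛ : ∀ g, ∀ v ∈ Λ, A g v ∈ Λ) (χ : G →* ℤˣ) :
    Submodule.span ℝ {φ : isotypicDual A χ | ∀ v ∈ Λ, ∃ m : ℤ, φ.1 v = m} = ⊤ := by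
  have : Module.Free ℤ Λ := ZLattice.module_free ℝ Λ
  have : Module.Finite ℤ Λ := ZLattice.module_finite ℝ Λ
  let b := Module.Free.chooseBasis ℤ Λ
  let b' := b.ofZLatticeBasis ℝ Λ
  have hb : ∀ i, ∀ v ∈ Λ, ∃ m : ℤ, b'.coord i v = m := fun i v hv =>
    ⟨b.repr ⟨v, hv⟩ i, b.ofZLatticeBasis_repr_apply ℝ Λ ⟨v, hv⟩ i⟩
  rw [eq_top_iff]
  rintro φ -
  have hφ : φ = ∑ i, ((Fintype.card G : ℝ)⁻¹ * φ.1 (b' i)) •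
      (⟨twistedSum (realification A) χ (b'.coord i), twistedSum_mem_isotypicDual A χ _⟩ :
        isotypicDual A χ) := by
    refine Subtype.ext (LinearMap.ext fun z => ?_)
    have h1 := twistedSum_of_eigen (realification A) χ φ.1 φ.2 z
    have hcard : (Fintype.card G : ℝ) ≠ 0 := by exact_mod_cast Fintype.card_ne_zero
    rw [zsmul_eq_mul, Int.cast_natCast] at h1
    rw [← mul_right_inj' hcard, ← h1, twistedSum_apply]
    simp only [Submodule.coe_sum, Submodule.coe_smul, LinearMap.sum_apply,
      LinearMap.smul_apply, twistedSum_apply]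
    have h2 : ∀ z, φ.1 z = ∑ i, φ.1 (b' i) * b'.coord i z := fun z => by
      conv_lhs => rw [← b'.sum_repr z, map_sum]
      exact Finset.sum_congr rfl fun i _ => by
        rw [map_smul, smul_eq_mul, mul_comm]; rfl
    simp only [fun g => h2 (realification A g z), Finset.smul_sum, Finset.mul_sum]
    rw [Finset.sum_comm]
    refine Finset.sum_congr rfl fun i _ => Finset.sum_congr rfl fun g _ => ?_
    simp only [zsmul_eq_mul, smul_eq_mul]
    field_simp
  rw [hφ]
  exact Submodule.sum_mem _ fun i _ => Submodule.smul_mem _ _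
    (Submodule.subset_span (twistedSum_integral hΛ χ (hb i)))

theorem exists_linear_extension [DiscreteTopology Λ] [IsZLattice ℝ Λ] (f : Λ →ₗ[ℤ] ℤ) :
    ∃ F : (Fin n → ℂ) →ₗ[ℝ] ℝ, ∀ v : Λ, F v = f v := by
  have : Module.Free ℤ Λ := ZLattice.module_free ℝ Λ
  let b := Module.Free.chooseBasis ℤ Λ
  let F := (b.ofZLatticeBasis ℝ Λ).constr ℝ fun i => (f (b i) : ℝ)
  have h : (F.restrictScalars ℤ) ∘ₗ Λ.subtype = (Algebra.linearMap ℤ ℝ) ∘ₗ f := by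
    refine b.ext fun i => ?_
    change F (b i) = f (b i)
    rw [← b.ofZLatticeBasis_apply ℝ Λ i, Module.Basis.constr_basis]
  exact ⟨F, fun v => LinearMap.congr_fun h v⟩

end Isotypic

/-- For an extension `Γ` of `G` acting injectively and with linear part `A`, and for each
nontrivial `c ∈ G`, a `c`-invariant integral functional that is odd on the squares of the lifts
of `c`. -/
theorem exists_functional_odd_sq {Γ G : Type} [Group Γ] [Group G] (hG : IsElementaryTwo G)
    (π : Γ →* G) (hπ : Function.Surjective π) {n : ℕ} (Ψ : Γ →* Equiv.Perm (Fin n → ℂ))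
    (hinj : Function.Injective Ψ) (hsq : ∀ γ, Ψ γ * Ψ γ = 1 → Ψ γ = 1)
    (A : Representation ℂ G (Fin n → ℂ)) (hA : ∀ γ z, Ψ γ z = A (π γ) z + Ψ γ 0)
    {Λ : Submodule ℤ (Fin n → ℂ)} (hΛ : ∀ v, v ∈ Λ ↔ ∃ γ, π γ = 1 ∧ Ψ γ 0 = v)
    [DiscreteTopology Λ] [IsZLattice ℝ Λ] (hAΛ : ∀ g, ∀ v ∈ Λ, A g v ∈ Λ) {c : G} (hc : c ≠ 1) :
    ∃ F : (Fin n → ℂ) →ₗ[ℝ] ℝ, (∀ v ∈ Λ, ∃ m : ℤ, F v = m) ∧ (∀ z, F (A c z) = F z) ∧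
      ∀ γ, π γ = c → F (Ψ (γ * γ) 0) ≠ 0 := by
  have : Module.Free ℤ Λ := ZLattice.module_free ℝ Λ
  have : Module.Finite ℤ Λ := ZLattice.module_finite ℝ Λ
  have hAA : ∀ z, A c (A c z) = z := fun z => by
    rw [← Module.End.mul_apply, ← map_mul, hG.mul_self, map_one]; rfl
  have hsq0 : ∀ γ, π γ = c → Ψ (γ * γ) 0 = A c (Ψ γ 0) + Ψ γ 0 := fun γ hγ => by
    rw [map_mul, Equiv.Perm.mul_apply, hA γ, hγ]
  obtain ⟨γ₀, hγ₀⟩ := hπ c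
  have hw : Ψ (γ₀ * γ₀) 0 ∈ Λ := (hΛ _).2 ⟨γ₀ * γ₀, by rw [map_mul, hγ₀, hG.mul_self], rfl⟩
  let cΛ : Λ →ₗ[ℤ] Λ := ((A c).restrictScalars ℤ).restrict (hAΛ c)
  obtain ⟨f, hf1, hf2⟩ := exists_invariant_functional_odd cΛ (fun x => Subtype.ext (hAA x))
    (w := ⟨_, hw⟩) (Subtype.ext (by
      change A c (Ψ (γ₀ * γ₀) 0) = Ψ (γ₀ * γ₀) 0
      rw [hsq0 γ₀ hγ₀, map_add, hAA, add_comm])) (by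
      rintro ⟨y, hy⟩ h
      have h := congrArg Subtype.val h
      change y + A c y = Ψ (γ₀ * γ₀) 0 at h
      obtain ⟨δ, hδ, rfl⟩ := (hΛ y).1 hy
      -- If the square of `γ₀` were a norm y + cy, then correcting the lift by the translation y
      -- would give a lift of c with trivial square, contradicting `hsq`.
      have hε : π (δ⁻¹ * γ₀) = c := by simp [hδ, hγ₀]
      have h0 : Ψ γ₀ 0 = Ψ δ 0 + Ψ (δ⁻¹ * γ₀) 0 := by
        have h1 : Ψ γ₀ 0 = Ψ (δ * (δ⁻¹ * γ₀)) 0 := by rw [mul_inv_cancel_left]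
        rw [h1, map_mul, Equiv.Perm.mul_apply, hA δ, hδ, map_one, Module.End.one_apply, add_comm]
      have h2 : Ψ ((δ⁻¹ * γ₀) * (δ⁻¹ * γ₀)) 0 = 0 := by
        rw [hsq0 _ hε]
        rw [hsq0 _ hγ₀, h0, map_add] at h
        have h3 : Ψ δ 0 + A c (Ψ δ 0) + 0 =
            Ψ δ 0 + A c (Ψ δ 0) + (A c (Ψ (δ⁻¹ * γ₀) 0) + Ψ (δ⁻¹ * γ₀) 0) := by
          rw [add_zero]; nth_rw 1 [h]; abel
        exact (add_left_cancel h3).symm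
      have h4 : Ψ (δ⁻¹ * γ₀) * Ψ (δ⁻¹ * γ₀) = 1 := by
        rw [← map_mul]
        refine Equiv.ext fun z => ?_
        rw [hA, h2, map_mul, hε, hG.mul_self, map_one, add_zero]
        rfl
      have h5 := hinj ((hsq _ h4).trans (map_one Ψ).symm)
      rw [h5, map_one] at hε
      exact hc hε.symm)
  obtain ⟨F, hF⟩ := exists_linear_extension f
  refine ⟨F, fun v hv => ⟨f ⟨v, hv⟩, hF ⟨v, hv⟩⟩, fun z => ?_, fun γ hγ => ?_⟩
  · have h1 : F ∘ₗ (realification A c) = F := by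
      refine LinearMap.ext_on (IsZLattice.span_top (K := ℝ) (L := Λ)) fun v hv => ?_
      have h2 := hF (cΛ ⟨v, hv⟩)
      rw [hf1] at h2
      exact h2.trans (hF ⟨v, hv⟩).symm
    exact LinearMap.congr_fun h1 z
  · have hδ : π (γ * γ₀⁻¹) = 1 := by rw [map_mul, map_inv, hγ, hγ₀, mul_inv_cancel]
    have hy : Ψ (γ * γ₀⁻¹) 0 ∈ Λ := (hΛ _).2 ⟨_, hδ, rfl⟩
    have h0 : Ψ γ 0 = Ψ (γ * γ₀⁻¹) 0 + Ψ γ₀ 0 := by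
      have h1 : Ψ γ 0 = Ψ ((γ * γ₀⁻¹) * γ₀) 0 := by rw [inv_mul_cancel_right]
      rw [h1, map_mul, Equiv.Perm.mul_apply, hA (γ * γ₀⁻¹), hδ, map_one, Module.End.one_apply,
        add_comm]
    let y : Λ := ⟨_, hy⟩
    let w : Λ := ⟨_, hw⟩
    -- Changing the lift of c by a lattice vector changes its square by a norm, on which the
    -- invariant functional is even.
    have h1 : Ψ (γ * γ) 0 = (cΛ y + y + w : Λ) := by
      change _ = A c (Ψ (γ * γ₀⁻¹) 0) + Ψ (γ * γ₀⁻¹) 0 + Ψ (γ₀ * γ₀) 0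
      rw [hsq0 γ hγ, hsq0 γ₀ hγ₀, h0, map_add]
      abel
    rw [h1, hF, map_add, map_add, hf1]
    intro h2
    have h3 : f y + f y + f w = 0 := by exact_mod_cast h2
    have h4 : Odd (f w) := hf2
    rw [← Int.not_even_iff_odd] at h4
    exact h4 ⟨-f y, by omega⟩

/-! ### The upper bound for the complex Vasquez number -/

theorem IsElementaryTwo.isComplexVasquezBound {G : Type} [Group G] [Fintype G]
    (hG : IsElementaryTwo G) : IsComplexVasquezBound G (Nat.card (AnnPair G) / 2) := by
  classical
  rintro Γ _ n ⟨Λ₀, Δ, hΔ, ⟨e⟩⟩ L _ hL ⟨q⟩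
  let π : Γ →* G := q.toMonoidHom.comp (QuotientGroup.mk' L)
  have hπ : Function.Surjective π := q.surjective.comp (QuotientGroup.mk'_surjective L)
  have hπL : ∀ γ, π γ = 1 ↔ γ ∈ L := fun γ => by
    change q (QuotientGroup.mk' L γ) = 1 ↔ _
    rw [map_eq_one_iff q q.injective, ← MonoidHom.mem_ker, QuotientGroup.ker_mk']
  let Ψ : Γ →* Equiv.Perm (Fin n → ℂ) := Δ.subtype.comp e.toMonoidHom
  have hinj : Function.Injective Ψ := Δ.subtype_injective.comp e.injective
  have hrange : Ψ.range = Δ := by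
    ext p
    constructor
    · rintro ⟨γ, rfl⟩
      exact (e γ).2
    · intro hp
      exact ⟨e.symm ⟨p, hp⟩, by simp [Ψ]⟩
  rw [← hrange] at hΔ
  obtain ⟨hsq, A, hA, Λ, hΛ, _, hspan⟩ := hΔ.exists_linearPart π hπ
    (fun x y hx hy => hL.1.2 x ((hπL x).1 hx) y ((hπL y).1 hy)) Ψ
  have : IsZLattice ℝ Λ := ⟨hspan⟩
  have hAΛ : ∀ g, ∀ v ∈ Λ, A g v ∈ Λ := by
    intro g v hv
    obtain ⟨γ, rfl⟩ := hπ g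
    obtain ⟨δ, hδ, rfl⟩ := (hΛ v).1 hv
    refine (hΛ _).2 ⟨γ * δ * γ⁻¹, by simp [hδ], ?_⟩
    rw [map_mul, map_mul, Equiv.Perm.mul_apply, Equiv.Perm.mul_apply, hA δ, hδ, map_one,
      Module.End.one_apply, hA γ, map_add, add_assoc, add_comm (A (π γ) (Ψ δ 0)), ← add_assoc,
      ← hA γ, ← Equiv.Perm.mul_apply, ← map_mul, mul_inv_cancel, map_one]
    simp
  choose F hFint hFinv hFsq using fun (c : G) (hc : c ≠ 1) =>
    exists_functional_odd_sq hG π hπ Ψ hinj hsq A hA hΛ hAΛ hc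
  -- For each χ the components of the detecting functionals are replaced by an independent integral
  -- set of even size spanning them. Its size is at most the number of c ≠ 1 with χ(c) = 1, plus
  -- one; the one is the pair (1, χ).
  have hsel := fun χ : G →* ℤˣ => exists_even_linearIndependent (even_finrank_isotypicDual A χ)
    (W := isotypicDual A χ) (ι := {c : G // c ≠ 1 ∧ χ c = 1})
    (S := {φ : isotypicDual A χ | ∀ v ∈ Λ, ∃ m : ℤ, φ.1 v = m})
    (fun c => ⟨twistedSum (realification A) χ (F c.1 c.2.1), twistedSum_mem_isotypicDual A χ _⟩)
    (span_integral_isotypicDual hAΛ χ)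
    (fun c => twistedSum_integral hAΛ χ (hFint c.1 c.2.1))
  choose b hbint hbli hbeven hbcard hbspan using hsel
  have hbfin : ∀ χ, (b χ).Finite := fun χ => (hbli χ).setFinite
  have := fun χ => (hbfin χ).fintype
  have := Fintype.ofFinite (G →* ℤˣ)
  let φ : (Σ χ, b χ) → (Fin n → ℂ) →ₗ[ℝ] ℝ := fun j => j.2.1.1
  have hφ : ∀ j g z, φ j (A g z) = ((j.1 g : ℤˣ) : ℤ) • φ j z := fun j => j.2.1.2
  have : IsAddTorsionFree ((Fin n → ℂ) →ₗ[ℝ] ℝ) :=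
    ⟨fun N hN f f' h => LinearMap.ext fun z => nsmul_right_injective hN (LinearMap.congr_fun h z)⟩
  have hφli : LinearIndependent ℝ φ := by
    rw [Fintype.linearIndependent_iff]
    intro a ha
    rw [Fintype.sum_sigma] at ha
    have hblock := eq_zero_of_sum_eigenvector_eq_zero
      (fun g => (LinearMap.lcomp ℝ ℝ (realification A g)).toAddMonoidHom)
      (fun χ => ∑ j : b χ, a ⟨χ, j⟩ • φ ⟨χ, j⟩) (fun χ g => by
        refine LinearMap.ext fun z => ?_
        change (∑ j : b χ, a ⟨χ, j⟩ • φ ⟨χ, j⟩) (A g z) =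
          ((χ g : ℤˣ) : ℤ) • (∑ j : b χ, a ⟨χ, j⟩ • φ ⟨χ, j⟩) z
        simp only [LinearMap.sum_apply, LinearMap.smul_apply, hφ, Finset.smul_sum]
        exact Finset.sum_congr rfl fun j _ => smul_comm _ _ _) ha
    rintro ⟨χ, j⟩
    refine Fintype.linearIndependent_iff.1 (hbli χ) (fun j => a ⟨χ, j⟩) (Subtype.ext ?_) j
    simpa [φ] using hblock χ
  let t : Γ → (Σ χ, b χ) → ℝ := fun γ j => φ j (Ψ γ 0)
  have hfree : ∀ γ, π γ ≠ 1 → t (γ * γ) ≠ 0 := by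
    intro γ hγ h0
    refine hFsq (π γ) hγ γ rfl (eq_zero_of_twistedSum (realification A) _ hG
      (hFinv _ hγ) fun χ hχ => ?_)
    have h1 := hbspan χ ⟨π γ, hγ, hχ⟩
    let ev : isotypicDual A χ →ₗ[ℝ] ℝ :=
      (LinearMap.applyₗ (Ψ (γ * γ) 0)) ∘ₗ (isotypicDual A χ).subtype
    have h2 : Submodule.span ℝ (b χ) ≤ LinearMap.ker ev :=
      Submodule.span_le.2 fun ψ hψ => congrFun h0 ⟨χ, ψ, hψ⟩
    exact h2 h1
  have hfib : ∀ χ, Nat.card {j : Σ χ, b χ // j.1 = χ} = (b χ).ncard := fun χ =>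
    (Nat.card_congr (Equiv.sigmaSubtype χ)).trans (Nat.card_coe_set_eq _)
  have hcard : Fintype.card (Σ χ, b χ) = ∑ χ, (b χ).ncard := by
    rw [Fintype.card_sigma]
    exact Finset.sum_congr rfl fun χ _ => by rw [← Nat.card_eq_fintype_card, Nat.card_coe_set_eq]
  have hcard_even : Even (Fintype.card (Σ χ, b χ)) := by
    rw [hcard]
    exact Finset.even_sum _ fun χ _ => hbeven χ
  have hcard_le : Fintype.card (Σ χ, b χ) ≤ Nat.card (AnnPair G) := by
    rw [hcard, card_annPair_eq_sum]
    exact Finset.sum_le_sum fun χ _ => (hbcard χ).trans (card_ne_one_char_eq_one χ).le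
  obtain ⟨m, hm⟩ := hcard_even
  obtain ⟨Λ', Ψ', hΨ', hker⟩ := exists_hyperelliptic_of_crossedHom hG π Sigma.fst
    (fun χ => by rw [hfib]; exact hbeven χ) t (fun γ δ j => by
      change φ j (Ψ (γ * δ) 0) = φ j (Ψ γ 0) + _ * φ j (Ψ δ 0)
      rw [map_mul, Equiv.Perm.mul_apply, hA γ, map_add, hφ, zsmul_eq_mul, add_comm])
    (fun γ hγ j => hbint j.1 j.2.2 _ ((hΛ _).2 ⟨γ, hγ, rfl⟩)) (by
      have h1 : t '' {γ | π γ = 1} = LinearMap.pi φ '' (Λ : Set (Fin n → ℂ)) := by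
        ext x
        constructor
        · rintro ⟨γ, hγ, rfl⟩
          exact ⟨Ψ γ 0, (hΛ _).2 ⟨γ, hγ, rfl⟩, rfl⟩
        · rintro ⟨v, hv, rfl⟩
          obtain ⟨γ, hγ, rfl⟩ := (hΛ v).1 hv
          exact ⟨γ, hγ, rfl⟩
      rw [h1, Submodule.span_image, hspan, Submodule.map_top]
      exact pi_surjective_of_linearIndependent φ hφli) hfree (n := m) (by omega)
  -- M is the kernel of the action on the selected coordinates.
  refine ⟨Ψ'.ker, inferInstance, fun γ hγ => (hπL γ).1 (hker γ hγ).1, m, by omega, ?_⟩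
  exact ⟨Λ', Ψ'.range, hΨ', ⟨QuotientGroup.quotientKerEquivRange Ψ'⟩⟩

/-! ### An extension of `G` by its coset lattice -/

section CosetExtension

variable {G : Type} [Group G]

/-- The extension of `G` by `cosetLattice Set.univ` with cocycle `cosetCocycle`. -/
@[ext]
structure CosetExtension (hG : IsElementaryTwo G) where
  /-- The component in the lattice. -/
  lat : cosetLattice (Set.univ : Set G)
  /-- The component in the group. -/
  elt : G

variable (hG : IsElementaryTwo G)

theorem forall_ne_one_mem_univ : ∀ c : G, c ≠ 1 → c ∈ (Set.univ : Set G) :=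
  fun c _ => Set.mem_univ c

namespace CosetExtension

/-- The cocycle of the extension. -/
noncomputable abbrev cocycle (g h : G) : cosetLattice (Set.univ : Set G) :=
  cosetCocycle hG forall_ne_one_mem_univ g h

theorem cocycle_one_left (g : G) : cocycle hG 1 g = 0 :=
  Subtype.ext (funext fun c => funext fun x => by simp)

theorem cocycle_one_right (g : G) : cocycle hG g 1 = 0 :=
  Subtype.ext (funext fun c => funext fun x => by simp)

theorem cosetRep_cocycle (a g h : G) : cosetRep hG _ a (cocycle hG g h) = cocycle hG g h := rfl

theorem cocycle_add (g h k : G) :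
    cocycle hG g h + cocycle hG (g * h) k = cocycle hG h k + cocycle hG g (h * k) :=
  Subtype.ext (funext fun c => funext fun x => by
    change indicator hG c g * indicator hG c h + indicator hG c (g * h) * indicator hG c k =
      indicator hG c h * indicator hG c k + indicator hG c g * indicator hG c (h * k)
    rw [indicator_mul, indicator_mul]
    ring)

noncomputable instance : Group (CosetExtension hG) :=
  letI : Mul (CosetExtension hG) :=
    ⟨fun a b => ⟨a.lat + cosetRep hG _ a.elt b.lat + cocycle hG a.elt b.elt, a.elt * b.elt⟩⟩
  letI : One (CosetExtension hG) := ⟨⟨0, 1⟩⟩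
  letI : Inv (CosetExtension hG) :=
    ⟨fun a => ⟨-cosetRep hG _ a.elt a.lat - cocycle hG a.elt a.elt, a.elt⟩⟩
  Group.ofLeftAxioms
    (fun a b c => CosetExtension.ext (by
      change a.lat + cosetRep hG _ a.elt b.lat + cocycle hG a.elt b.elt +
          cosetRep hG _ (a.elt * b.elt) c.lat + cocycle hG (a.elt * b.elt) c.elt =
        a.lat + cosetRep hG _ a.elt (b.lat + cosetRep hG _ b.elt c.lat +
          cocycle hG b.elt c.elt) + cocycle hG a.elt (b.elt * c.elt)
      have h := cocycle_add hG a.elt b.elt c.elt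
      rw [map_add, map_add, cosetRep_cocycle, map_mul, Module.End.mul_apply, ← sub_eq_zero]
      rw [← sub_eq_zero] at h
      rw [← h]
      abel) (mul_assoc _ _ _))
    (fun a => CosetExtension.ext (by
      change 0 + cosetRep hG _ 1 a.lat + cocycle hG 1 a.elt = a.lat
      rw [map_one, cocycle_one_left, Module.End.one_apply, zero_add, add_zero]) (one_mul _))
    (fun a => CosetExtension.ext (by
      change -cosetRep hG _ a.elt a.lat - cocycle hG a.elt a.elt + cosetRep hG _ a.elt a.lat +
        cocycle hG a.elt a.elt = 0
      abel) (hG.mul_self _))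

theorem mul_lat (a b : CosetExtension hG) :
    (a * b).lat = a.lat + cosetRep hG _ a.elt b.lat + cocycle hG a.elt b.elt := rfl

/-- The projection of the extension to `G`. -/
noncomputable def proj : CosetExtension hG →* G where
  toFun := elt
  map_one' := rfl
  map_mul' _ _ := rfl

theorem proj_apply (a : CosetExtension hG) : proj hG a = a.elt := rfl

theorem proj_surjective : Function.Surjective (proj hG) := fun g => ⟨⟨0, g⟩, rfl⟩

theorem mul_eq_of_elt_eq_one {a b : CosetExtension hG} (ha : a.elt = 1) :
    a * b = ⟨a.lat + b.lat, b.elt⟩ := by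
  refine CosetExtension.ext ?_ ?_
  · rw [mul_lat, ha, map_one, cocycle_one_left, add_zero, Module.End.one_apply]
  · change a.elt * b.elt = b.elt
    rw [ha, one_mul]

theorem commute_of_elt_eq_one (a b : CosetExtension hG) (ha : proj hG a = 1)
    (hb : proj hG b = 1) : a * b = b * a := by
  rw [mul_eq_of_elt_eq_one hG ha, mul_eq_of_elt_eq_one hG hb, add_comm]
  exact CosetExtension.ext rfl (hb.trans ha.symm)

/-- If a lies in an abelian normal subgroup, it commutes with its conjugate by the translation y.
Comparing lattice parts gives 2y = 2(a·y), so a acts trivially on the lattice, and faithfulness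
gives `a.elt = 1`. -/
theorem isMaxAbelianNormal_ker [Fintype G] (h4 : 4 ≤ Fintype.card G) :
    IsMaxAbelianNormal (proj hG).ker := by
  refine ⟨⟨inferInstance, fun a ha b hb => commute_of_elt_eq_one hG a b ha hb⟩, ?_⟩
  rintro H ⟨hH, hcomm⟩ a ha
  change a.elt = 1
  refine cosetRep_injective hG h4 forall_ne_one_mem_univ ?_
  rw [map_one]
  refine LinearMap.ext fun y => ?_
  let τ : CosetExtension hG := ⟨y, 1⟩
  have h1 := hcomm _ (hH.conj_mem a ha τ) a ha
  have hinv : τ⁻¹ = ⟨-y, 1⟩ := by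
    rw [inv_eq_iff_mul_eq_one, mul_eq_of_elt_eq_one hG rfl]
    exact CosetExtension.ext (add_neg_cancel y) rfl
  have h2 : τ * a * τ⁻¹ = ⟨y + a.lat - cosetRep hG _ a.elt y, a.elt⟩ := by
    rw [hinv, mul_eq_of_elt_eq_one hG (a := τ) rfl]
    refine CosetExtension.ext ?_ (mul_one _)
    rw [mul_lat, cocycle_one_right, add_zero, map_neg, sub_eq_add_neg]
  rw [h2] at h1
  have h3 := congrArg lat h1
  rw [mul_lat, mul_lat] at h3
  simp only [map_add, map_sub] at h3
  have h4 : cosetRep hG Set.univ a.elt (cosetRep hG Set.univ a.elt y) = y := by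
    rw [← Module.End.mul_apply, ← map_mul, hG.mul_self, map_one]; rfl
  rw [h4] at h3
  have h5 : (2 : ℤ) • y = (2 : ℤ) • cosetRep hG Set.univ a.elt y := by
    rw [two_smul, two_smul, ← sub_eq_zero]
    rw [← sub_eq_zero] at h3
    rw [← h3]
    abel
  exact (smul_right_injective _ (two_ne_zero' ℤ) h5).symm

/-- Evaluation of an element of the coset lattice at the identity of the component at `c`. -/
def evalOne (c : G) : cosetLattice (Set.univ : Set G) →ₗ[ℤ] ℤ where
  toFun x := x.1 c 1
  map_add' _ _ := rfl
  map_smul' _ _ := rfl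

theorem evalOne_cosetRep (c : G) (x : cosetLattice (Set.univ : Set G)) :
    evalOne c (cosetRep hG _ c x) = evalOne c x := by
  change x.1 c (1 * c) = x.1 c 1
  rw [x.2.1]

/-- The invariant element of the coset lattice whose component at `c` is `indicator hG c g`. -/
noncomputable def translationPart (g : G) : cosetLattice (Set.univ : Set G) :=
  cosetConst forall_ne_one_mem_univ (fun c => indicator hG c g) (by simp)

theorem translationPart_one : translationPart hG 1 = 0 :=
  Subtype.ext (funext fun c => funext fun _ => indicator_one_right hG c)

/-- The indicators are additive up to twice a product, so half of `translationPart` bounds the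
cocycle rationally. This turns the extension into affine maps of the real span of the lattice. -/
theorem translationPart_mul (g h : G) :
    translationPart hG (g * h) + (2 : ℤ) • cocycle hG g h =
      translationPart hG g + translationPart hG h :=
  Subtype.ext (funext fun c => funext fun _ => by
    change indicator hG c (g * h) + 2 * (indicator hG c g * indicator hG c h) =
      indicator hG c g + indicator hG c h
    rw [indicator_mul]
    ring)

variable [Fintype G]

/-- The Fourier coefficients of an element of the coset lattice. -/
noncomputable def fourier (p : AnnPair G) : cosetLattice (Set.univ : Set G) →ₗ[ℤ] ℤ :=
  twistedSum (cosetRep hG _) p.1.2 (evalOne p.1.1)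

theorem fourier_cosetRep (p : AnnPair G) (g : G) (x : cosetLattice (Set.univ : Set G)) :
    fourier hG p (cosetRep hG _ g x) = ((p.1.2 g : ℤˣ) : ℤ) * fourier hG p x :=
  twistedSum_apply_rho _ _ _ _ _

open Classical in
theorem fourier_cosetEigenvector (p q : AnnPair G) :
    fourier hG p (cosetEigenvector q.1.1 q.1.2 (Set.mem_univ _) q.2) =
      if p = q then (Fintype.card G : ℤ) else 0 := by
  rw [fourier, twistedSum_apply]
  simp only [cosetRep_cosetEigenvector, map_smul, smul_smul, ← Finset.sum_smul,
    sum_group_char_mul]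
  change _ * (cosetEigenvector q.1.1 q.1.2 (Set.mem_univ _) q.2).1 p.1.1 1 = _
  rw [cosetEigenvector_apply]
  by_cases h1 : p.1.1 = q.1.1
  · by_cases h2 : p.1.2 = q.1.2
    · have : p = q := Subtype.ext (Prod.ext h1 h2)
      simp [this]
    · have : p ≠ q := fun e => h2 (by rw [e])
      simp [this, h2]
  · have : p ≠ q := fun e => h1 (by rw [e])
    simp [this, h1]

theorem fourier_translationPart (p : AnnPair G) (g h : G) :
    ((p.1.2 g : ℤˣ) : ℤ) * fourier hG p (translationPart hG h) =
      fourier hG p (translationPart hG h) :=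
  (fourier_cosetRep hG p g _).symm

/-- The crossed homomorphism describing the translation parts of the affine action of the
extension, in Fourier coordinates. -/
noncomputable def crossed (a : CosetExtension hG) (p : AnnPair G) : ℝ :=
  fourier hG p a.lat + (fourier hG p (translationPart hG a.elt) : ℝ) / 2

theorem crossed_of_elt_eq_one {a : CosetExtension hG} (ha : a.elt = 1) (p : AnnPair G) :
    crossed hG a p = fourier hG p a.lat := by
  rw [crossed, ha, translationPart_one, map_zero, Int.cast_zero, zero_div, add_zero]

theorem crossed_mul (a b : CosetExtension hG) (p : AnnPair G) :
    crossed hG (a * b) p =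
      crossed hG a p + ((p.1.2 (proj hG a) : ℤˣ) : ℤ) * crossed hG b p := by
  have h1 : fourier hG p (a * b).lat = fourier hG p a.lat +
      ((p.1.2 a.elt : ℤˣ) : ℤ) * fourier hG p b.lat + fourier hG p (cocycle hG a.elt b.elt) := by
    rw [mul_lat, map_add, map_add, fourier_cosetRep]
  have h2 := congrArg (fourier hG p) (translationPart_mul hG a.elt b.elt)
  rw [map_add, map_add, map_smul, smul_eq_mul,
    ← fourier_translationPart hG p a.elt b.elt] at h2
  have h1' : (fourier hG p (a * b).lat : ℝ) = fourier hG p a.lat +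
      ((p.1.2 a.elt : ℤˣ) : ℤ) * fourier hG p b.lat + fourier hG p (cocycle hG a.elt b.elt) := by
    exact_mod_cast h1
  have h2' : (fourier hG p (translationPart hG (a.elt * b.elt)) : ℝ) +
      2 * fourier hG p (cocycle hG a.elt b.elt) = fourier hG p (translationPart hG a.elt) +
      ((p.1.2 a.elt : ℤˣ) : ℤ) * fourier hG p (translationPart hG b.elt) := by
    exact_mod_cast h2
  change (fourier hG p (a * b).lat : ℝ) +
      (fourier hG p (translationPart hG (a.elt * b.elt)) : ℝ) / 2 =
    fourier hG p a.lat + (fourier hG p (translationPart hG a.elt) : ℝ) / 2 +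
      ((p.1.2 a.elt : ℤˣ) : ℤ) *
        (fourier hG p b.lat + (fourier hG p (translationPart hG b.elt) : ℝ) / 2)
  rw [h1']
  linear_combination h2' / 2

/-- Fourier coefficients are real coordinates in which χ occurs once for each element of its kernel,
an even number of times. The summand at c = 1 supplies the coordinate that makes these
multiplicities even. -/
theorem isAsphericalKahlerGroup (h4 : 4 ∣ Fintype.card G) {n : ℕ}
    (hn : 2 * n = Nat.card (AnnPair G)) : IsAsphericalKahlerGroup (CosetExtension hG) n := by
  classical
  have := Fintype.ofFinite (AnnPair G)
  obtain ⟨Λ, Ψ, hΨ, hker⟩ := exists_hyperelliptic_of_crossedHom hG (proj hG)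
    (fun p : AnnPair G => p.1.2) (fun χ => by
      let E : {p : AnnPair G // p.1.2 = χ} ≃ {g : G // χ g = 1} :=
        { toFun := fun p => ⟨p.1.1.1, (congrArg (fun ψ : G →* ℤˣ => ψ p.1.1.1) p.2).symm.trans p.1.2⟩
          invFun := fun g => ⟨⟨(g.1, χ), g.2⟩, rfl⟩
          left_inv := by rintro ⟨⟨⟨c, χ'⟩, h⟩, rfl⟩; rfl
          right_inv := fun g => rfl }
      rw [Nat.card_congr E, Nat.card_eq_fintype_card]
      exact even_card_char_eq_one h4 χ) (crossed hG) (crossed_mul hG)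
    (fun a ha p => ⟨_, crossed_of_elt_eq_one hG ha p⟩) (by
      rw [eq_top_iff, ← (Pi.basisFun ℝ (AnnPair G)).span_eq, Submodule.span_le]
      rintro _ ⟨q, rfl⟩
      have h1 : crossed hG ⟨cosetEigenvector q.1.1 q.1.2 (Set.mem_univ _) q.2, 1⟩ ∈
          Submodule.span ℝ (crossed hG '' {a | proj hG a = 1}) :=
        Submodule.subset_span ⟨_, rfl, rfl⟩
      have h2 := Submodule.smul_mem _ ((Fintype.card G : ℝ)⁻¹) h1
      have h3 : Pi.basisFun ℝ (AnnPair G) q = (Fintype.card G : ℝ)⁻¹ •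
          crossed hG ⟨cosetEigenvector q.1.1 q.1.2 (Set.mem_univ _) q.2, 1⟩ := by
        funext p
        rw [Pi.smul_apply, crossed_of_elt_eq_one hG rfl, fourier_cosetEigenvector]
        have hcard : (Fintype.card G : ℝ) ≠ 0 := by exact_mod_cast Fintype.card_ne_zero
        by_cases h : p = q <;> simp [h, hcard]
      rw [h3]
      exact h2) (fun a (ha : a.elt ≠ 1) h0 => by
      have h1 : (a * a).elt = 1 := hG.mul_self _
      have h2 : evalOne a.elt (a * a).lat = 0 :=
        eq_zero_of_twistedSum (cosetRep hG _) _ hG (evalOne_cosetRep hG a.elt) fun χ hχ => by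
          have h3 := congrFun h0 ⟨(a.elt, χ), hχ⟩
          rw [crossed_of_elt_eq_one hG h1, Pi.zero_apply] at h3
          exact_mod_cast h3
      -- The square of a lift of c has an odd value 2m + 1 at the identity of the component at c, so
      -- it is not trivial.
      rw [mul_lat, map_add, map_add, evalOne_cosetRep] at h2
      change _ + indicator hG a.elt a.elt * indicator hG a.elt a.elt = 0 at h2
      rw [indicator_self hG ha] at h2
      omega) (n := n) (by rw [hn, Nat.card_eq_fintype_card])
  have hinj : Function.Injective Ψ := by
    refine (injective_iff_map_eq_one Ψ).2 fun a ha => ?_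
    obtain ⟨h1, h2⟩ := hker a ha
    refine CosetExtension.ext (Subtype.ext (funext fun c => funext fun g => ?_)) h1
    have h3 : evalOne c (cosetRep hG _ g a.lat) = 0 :=
      eq_zero_of_twistedSum (cosetRep hG _) _ hG (evalOne_cosetRep hG c) fun χ hχ => by
        have h4 := congrFun h2 ⟨(c, χ), hχ⟩
        rw [crossed_of_elt_eq_one hG h1, Pi.zero_apply] at h4
        have h5 : fourier hG ⟨(c, χ), hχ⟩ a.lat = 0 := by exact_mod_cast h4
        have h6 := fourier_cosetRep hG ⟨(c, χ), hχ⟩ g a.lat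
        rw [h5, mul_zero] at h6
        exact h6
    change a.lat.1 c (1 * g) = 0 at h3
    rw [one_mul] at h3
    exact h3
  exact ⟨Λ, Ψ.range, hΨ, ⟨MonoidHom.ofInjective hinj⟩⟩

end CosetExtension

end CosetExtension

/-! ### The lower bound for the complex Vasquez number -/

/-- In a discrete subgroup the ℤ-rank equals the dimension of the real span. -/
theorem LinearIndependent.real_of_int_of_discrete {E ι : Type} [NormedAddCommGroup E]
    [NormedSpace ℝ E] [FiniteDimensional ℝ E] [Finite ι] {v : ι → E}
    (hv : LinearIndependent ℤ v) (Λ : Submodule ℤ E) [DiscreteTopology Λ] (hΛ : ∀ i, v i ∈ Λ) :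
    LinearIndependent ℝ v := by
  have := Fintype.ofFinite ι
  have hle : Submodule.span ℤ (Set.range v) ≤ Λ := Submodule.span_le.2 (Set.range_subset_iff.2 hΛ)
  have hd : DiscreteTopology (Submodule.span ℤ (Set.range v)) :=
    DiscreteTopology.of_continuous_injective (f := Submodule.inclusion hle)
      (continuous_subtype_val.subtype_mk _) (Submodule.inclusion_injective hle)
  rw [linearIndependent_iff_card_eq_finrank_span, Real.finrank_eq_int_finrank_of_discrete hd]
  exact linearIndependent_iff_card_eq_finrank_span.1 hv

section Isotypic

variable {G : Type} [Group G] {n : ℕ} (A : Representation ℂ G (Fin n → ℂ))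

/-- The real subspace on which `G` acts through the sign character `χ`. -/
def isotypicSubspace (χ : G →* ℤˣ) : Submodule ℝ (Fin n → ℂ) where
  carrier := {z | ∀ g, A g z = ((χ g : ℤˣ) : ℤ) • z}
  zero_mem' := fun g => by simp
  add_mem' := fun {y z} hy hz g => by rw [map_add, hy, hz, smul_add]
  smul_mem' := fun r z hz g => by
    rw [← realification_apply, map_smul, realification_apply, hz, smul_comm]

theorem even_finrank_isotypicSubspace (χ : G →* ℤˣ) :
    Even (Module.finrank ℝ (isotypicSubspace A χ)) := by
  let I : (Fin n → ℂ) →ₗ[ℝ] (Fin n → ℂ) :=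
    ((Complex.I • LinearMap.id : (Fin n → ℂ) →ₗ[ℂ] (Fin n → ℂ))).restrictScalars ℝ
  have hI : ∀ z, I z = Complex.I • z := fun z => rfl
  refine even_finrank_of_mul_self_eq_neg_one (W := isotypicSubspace A χ)
    (I.restrict (p := isotypicSubspace A χ) (q := isotypicSubspace A χ) fun z hz g => ?_)
    fun z => Subtype.ext ?_
  · rw [hI, map_smul, hz, smul_comm]
  · change Complex.I • Complex.I • z.1 = -z.1
    rw [smul_smul, Complex.I_mul_I, neg_one_smul]

theorem sum_finrank_isotypicSubspace_le [Fintype G] [Fintype (G →* ℤˣ)] :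
    ∑ χ, Module.finrank ℝ (isotypicSubspace A χ) ≤ 2 * n := by
  let S : (∀ χ, isotypicSubspace A χ) →ₗ[ℝ] (Fin n → ℂ) :=
    ∑ χ, (isotypicSubspace A χ).subtype ∘ₗ LinearMap.proj χ
  have hS : ∀ x, S x = ∑ χ, (x χ : Fin n → ℂ) := fun x => by simp [S]
  have hinj : Function.Injective S := by
    refine (injective_iff_map_eq_zero S).2 fun x hx => funext fun χ => Subtype.ext ?_
    rw [hS] at hx
    exact eq_zero_of_sum_eigenvector_eq_zero (fun g => (A g).toAddMonoidHom) (fun χ => (x χ).1)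
      (fun χ g => (x χ).2 g) hx χ
  have h := LinearMap.finrank_le_finrank_of_injective hinj
  rw [Module.finrank_pi_fintype] at h
  have h2 : Module.finrank ℝ (Fin n → ℂ) = 2 * n := by
    rw [Module.finrank_pi_fintype]
    simp [Complex.finrank_real_complex, mul_comm]
  rwa [h2] at h

end Isotypic

-- A deck group quotient has no involutions, so no local class of the extension dies in it and the
-- eigenvectors indexed by pairs with c ≠ 1 stay independent. Parity of the real isotypic dimensions
-- then adds one for each character.
open CosetExtension in
theorem IsComplexVasquezBound.card_annPair_le {G : Type} [Group G] [Fintype G]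
    (hG : IsElementaryTwo G) (h4 : 4 ∣ Fintype.card G) {n : ℕ}
    (hn : 2 * n = Nat.card (AnnPair G)) {N : ℕ} (hN : IsComplexVasquezBound G N) : n ≤ N := by
  classical
  have h4' : 4 ≤ Fintype.card G := Nat.le_of_dvd Fintype.card_pos h4
  obtain ⟨M, hM, hML, m, hm, Λ, Δ, hΔ, ⟨e⟩⟩ := hN (CosetExtension hG) n
    (isAsphericalKahlerGroup hG h4 hn) (proj hG).ker (isMaxAbelianNormal_ker hG h4')
    ⟨QuotientGroup.quotientKerEquivOfSurjective _ (proj_surjective hG)⟩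
  refine le_trans ?_ hm
  let Ψ : CosetExtension hG →* Equiv.Perm (Fin m → ℂ) :=
    (Δ.subtype.comp e.toMonoidHom).comp (QuotientGroup.mk' M)
  have hker : ∀ a, Ψ a = 1 → a.elt = 1 := fun a ha => by
    have h1 : e (QuotientGroup.mk' M a) = 1 := Subtype.ext ha
    rw [map_eq_one_iff e e.injective, ← MonoidHom.mem_ker, QuotientGroup.ker_mk'] at h1
    exact hML h1
  have hrange : Ψ.range = Δ := by
    ext p
    constructor
    · rintro ⟨γ, rfl⟩
      exact (e _).2
    · intro hp
      obtain ⟨a, ha⟩ := QuotientGroup.mk'_surjective M (e.symm ⟨p, hp⟩)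
      exact ⟨a, by simp only [Ψ, MonoidHom.comp_apply, ha]; simp⟩
  rw [← hrange] at hΔ
  obtain ⟨hsq, A, hA, Λ', hΛ', _, -⟩ := hΔ.exists_linearPart (proj hG) (proj_surjective hG)
    (commute_of_elt_eq_one hG) Ψ
  have htr : ∀ a : CosetExtension hG, a.elt = 1 → ∀ z, Ψ a z = z + Ψ a 0 := fun a ha z => by
    rw [hA, proj_apply, ha, map_one]; rfl
  let ψ₀ : cosetLattice (Set.univ : Set G) →+ (Fin m → ℂ) :=
    { toFun := fun x => Ψ ⟨x, 1⟩ 0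
      map_zero' := by
        have : (⟨0, 1⟩ : CosetExtension hG) = 1 := rfl
        rw [this, map_one]; rfl
      map_add' := fun x y => by
        have : (⟨x + y, 1⟩ : CosetExtension hG) = ⟨y, 1⟩ * ⟨x, 1⟩ := by
          rw [mul_eq_of_elt_eq_one hG rfl, add_comm]
        rw [this, map_mul, Equiv.Perm.mul_apply, htr ⟨y, 1⟩ rfl] }
  let ψ : cosetLattice (Set.univ : Set G) →ₗ[ℤ] (Fin m → ℂ) := ψ₀.toIntLinearMap
  have hψ : ∀ x, ψ x = Ψ ⟨x, 1⟩ 0 := fun x => rfl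
  let ρ : Representation ℤ G (Fin m → ℂ) :=
    { toFun := fun g => (A g).restrictScalars ℤ
      map_one' := by rw [map_one]; rfl
      map_mul' := fun a b => by rw [map_mul]; rfl }
  have hρ : ∀ g x, ψ (cosetRep hG _ g x) = ρ g (ψ x) := by
    intro g x
    have h1 : (⟨0, g⟩ * ⟨x, 1⟩ : CosetExtension hG) =
        ⟨cosetRep hG _ g x, 1⟩ * ⟨0, g⟩ := by
      rw [mul_eq_of_elt_eq_one hG (a := ⟨cosetRep hG _ g x, 1⟩) rfl]
      refine CosetExtension.ext ?_ (mul_one g)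
      rw [mul_lat, cocycle_one_right, zero_add]
    have h2 := congrArg (fun a => Ψ a 0) h1
    simp only [map_mul, Equiv.Perm.mul_apply] at h2
    rw [htr ⟨cosetRep hG _ g x, 1⟩ rfl, hA ⟨0, g⟩, add_comm] at h2
    exact (add_left_cancel h2).symm
  have hli := linearIndependent_map_cosetEigenvector hG forall_ne_one_mem_univ ρ ψ hρ
    (fun c hc y hy => by
      -- The lift of c by -y kills the local class: its square acts trivially, hence by `hsq` so
      -- does the lift itself, although it lies over c ≠ 1.
      let a : CosetExtension hG := ⟨-y, c⟩
      have h1 : (a * a).elt = 1 := hG.mul_self c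
      have h2 : Ψ (a * a) 0 = 0 := by
        have h3 : a * a = ⟨(a * a).lat, 1⟩ := CosetExtension.ext rfl h1
        rw [h3, ← hψ, mul_lat, map_add, ← hy, map_neg, ← neg_add, map_neg, neg_add_cancel]
      refine hc (hker a (hsq a ?_))
      rw [← map_mul]
      refine Equiv.ext fun z => ?_
      rw [htr _ h1, h2, add_zero]
      rfl)
  have hliR := hli.real_of_int_of_discrete Λ' fun p => (hΛ' _).2 ⟨⟨_, 1⟩, rfl, rfl⟩
  have hblock : ∀ χ : G →* ℤˣ, Fintype.card {g : G // χ g = 1} ≤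
      Module.finrank ℝ (isotypicSubspace A χ) := by
    intro χ
    let v : {c : G // c ≠ 1 ∧ χ c = 1} → isotypicSubspace A χ := fun c =>
      ⟨ψ (cosetEigenvector c.1 χ (Set.mem_univ _) c.2.2), fun g => by
        have h1 := hρ g (cosetEigenvector c.1 χ (Set.mem_univ _) c.2.2)
        rw [cosetRep_cosetEigenvector, map_smul] at h1
        exact h1.symm⟩
    have hv : LinearIndependent ℝ v := by
      refine LinearIndependent.of_comp (isotypicSubspace A χ).subtype ?_
      exact hliR.comp (fun c : {c : G // c ≠ 1 ∧ χ c = 1} => ⟨(c.1, χ), c.2⟩)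
        fun c d hcd => Subtype.ext (congrArg (fun p : AnnPairNe G => p.1.1) hcd)
    have h1 := hv.fintype_card_le_finrank
    have h2 := card_ne_one_char_eq_one χ
    have h3 := even_card_char_eq_one h4 χ
    have h5 := even_finrank_isotypicSubspace A χ
    -- The independent vectors number one less than the even order of the kernel of χ, and the
    -- dimension is even, so it reaches that order.
    rw [Nat.even_iff] at h3 h5
    omega
  have := Fintype.ofFinite (G →* ℤˣ)
  have hsum := (Finset.sum_le_sum fun χ (_ : χ ∈ Finset.univ) => hblock χ).trans
    (sum_finrank_isotypicSubspace_le A)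
  rw [← card_annPair_eq_sum, ← hn] at hsum
  omega

theorem IsElementaryTwo.two_mul_complexVasquezNumber {G : Type} [Group G] [Fintype G]
    (hG : IsElementaryTwo G) (h4 : 4 ∣ Fintype.card G) :
    2 * complexVasquezNumber G = Nat.card (AnnPair G) := by
  classical
  have := Fintype.ofFinite (G →* ℤˣ)
  have heven : Even (Nat.card (AnnPair G)) := by
    rw [card_annPair_eq_sum]
    exact Finset.even_sum _ fun χ _ => even_card_char_eq_one h4 χ
  obtain ⟨n, hn⟩ := heven
  have h1 := hG.isComplexVasquezBound
  have h2 : complexVasquezNumber G = Nat.card (AnnPair G) / 2 :=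
    le_antisymm (Nat.sInf_le h1) (le_csInf ⟨_, h1⟩ fun N hN =>
      IsComplexVasquezBound.card_annPair_le hG h4 (by omega) hN)
  omega

/-! ### The main theorem -/

theorem mainTheorem5 (k : ℕ) (hk : 2 ≤ k) (G : Type) [Group G] [Fintype G]
    (hG : Nonempty (G ≃* Multiplicative (Fin k → ZMod 2))) :
    (complexVasquezNumber G : ℂ) =
        (1 / 2) * ((vasquezNumber G : ℂ) +
          ∑ᶠ χ ∈ irrCharOne G, (schurIndex χ : ℂ) * χ 1) ∧
      complexVasquezNumber G = 2 ^ (k - 1) + 2 ^ (k - 2) * (2 ^ k - 1) := by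
  classical
  obtain ⟨e⟩ := hG
  have hE := IsElementaryTwo.of_mulEquiv e
  have hcard : Fintype.card G = 2 ^ k := by
    rw [Fintype.card_congr (e.toEquiv.trans Multiplicative.toAdd)]
    simp
  -- Writing k = j + 2 removes the truncated subtractions from the exponents.
  obtain ⟨j, rfl⟩ : ∃ j, k = j + 2 := ⟨k - 2, by omega⟩
  have h4 : 4 ∣ Fintype.card G := by
    rw [hcard, pow_add]
    exact Dvd.intro_left _ rfl
  have := Fintype.ofFinite (G →* ℤˣ)
  have h1 := hE.two_mul_complexVasquezNumber h4
  have h2 := hE.vasquezNumber_eq (Nat.le_of_dvd Fintype.card_pos h4)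
  have h3 := hE.card_annPairNe
  have h5 := hE.card_annPair
  rw [Nat.card_eq_fintype_card] at h1 h2
  rw [hE.sum_schurIndex, h2]
  constructor
  · have h6 : 2 * complexVasquezNumber G = Fintype.card (AnnPairNe G) + Fintype.card G := by
      rw [h1, ← h3]
    have h7 : (2 : ℂ) * complexVasquezNumber G =
        Fintype.card (AnnPairNe G) + Fintype.card G := by exact_mod_cast h6
    linear_combination h7 / 2
  · rw [← h1, hcard] at h5
    obtain ⟨r, hr⟩ : ∃ r, 2 ^ (j + 2) = r + 1 := ⟨2 ^ (j + 2) - 1, by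
      have := Nat.one_le_two_pow (n := j + 2)
      omega⟩
    have h6 : j + 2 - 1 = j + 1 := by omega
    rw [h6, Nat.add_sub_cancel]
    have h7 : 2 ^ (j + 2) - 1 = r := by omega
    rw [h7]
    have h8 : (2 : ℕ) ^ (j + 2) = 4 * 2 ^ j := by ring
    have h9 : (2 : ℕ) ^ (j + 1) = 2 * 2 ^ j := by ring
    rw [hr] at h5
    rw [h8] at hr
    rw [h9]
    nlinarith
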